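/- **Setting.** Work in the affine coordinate $x$ of the supercircle $S^{1|2}$. Superfunctions are $f=f_0+\theta_1f_1+\theta_2f_2+\theta_1\theta_2f_{12}$ with $f_0,f_1,f_2,f_{12}$ smooth complex-valued functions of $x\in\mathbb R$ and $\theta_1,\theta_2$ odd Grassmann coordinates; $\tilde f$ denotes parity. Put $\bar D_i=\partial_{\theta_i}-\theta_i\partial_x$, $f'=\partial_xf$ and $$X_f=f\partial_x-(-1)^{\tilde f}\tfrac12\big(\bar D_1(f)\bar D_1+\bar D_2(f)\bar D_2\big),\qquad L^{w}_{X_f}=X_f+wf'\quad(w\in\mathbb C).$$ Let $\mathfrak{spo}(2|2)$ be spanned by the $X_f$ with $f\in\{1,x,\theta_1,\theta_2,\theta_1\theta_2,x^2,x\theta_1,x\theta_2\}$. Let $\lambda,\mu\in\mathbb C$, $\delta=\mu-\lambda$. For $k\in\frac12\mathbb N$ (with $0\in\mathbb N$), $\mathcal D^k_{\lambda\mu}$ is the space of operators $\sum_{l+\frac m2+\frac n2\le k}a_{l,m,n}\partial_x^l\bar D_1^m\bar D_2^n$ with superfunction coefficients, and $\mathcal D_{\lambda\mu}=\bigcup_k\mathcal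 D^k_{\lambda\mu}$, with action $\mathcal L_{X_f}D=L^\mu_{X_f}D-(-1)^{\tilde f\tilde D}DL^\lambda_{X_f}$. The symbol space is $\mathcal S_\delta=\bigoplus_k\mathcal S^k_\delta$, $\mathcal S^k_\delta=\mathcal D^k_{\lambda\mu}/\mathcal D^{k-1/2}_{\lambda\mu}$ (with $\mathcal D^{-1/2}_{\lambda\mu}=0$), with the induced action $L_{X_f}$. Elements of $\mathcal S^k_\delta$ are identified with pairs $(F_1,F_2)$ of superfunctions (with $F_2=0$ if $k=0$), representing the class of $$Q_{\rm Aff}(F_1,F_2)=\begin{cases}F_1\partial_x^k+F_2\partial_x^{k-1}\bar D_1\bar D_2,&k\in\mathbb N,\\ F_1\partial_x^{k-\frac12}\bar D_1+F_2\partial_x^{k-\frac12}\bar D_2,&k\in\frac12+\mathbb N.\end{cases}$$ This defines a linear bijection $Q_{\rm Aff}:\mathcal S_\delta\to\mathcal D_{\lambda\mu}$. The parity $\tilde S$ of a symbol $S=(F_1,F_2)$ is the common parity of $F_1$ and $F_2$; expressions containing $(-1)^{\tilde S}$ are extended linearly to all symbols. The Casimir operator of $\mathcal D_{\lambda\mu}$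 is $\sum_i\mathcal L_{u_i^*}\mathcal L_{u_i}$, where $(u_i)$ is the basis $X_1,X_{\theta_1},X_{\theta_2},X_x,X_{\theta_1\theta_2},X_{x\theta_1},X_{x\theta_2},X_{x^2}$ and $(u_i^*)$ is its dual basis $-\frac12X_{x^2},-X_{x\theta_1},-X_{x\theta_2},X_x,X_{\theta_1\theta_2},X_{\theta_1},X_{\theta_2},-\frac12X_1$ with respect to the form $2\,\mathrm{str}(AB)$; let $\mathcal C$ be the operator on $\mathcal S_\delta$ obtained from it by conjugation with $Q_{\rm Aff}$. Put $\alpha_k=(\delta-k)^2$ for $k\in\mathbb N$ and $\alpha_k=(\delta-k)^2-\frac14$ for $k\in\frac12+\mathbb N$. The value $\delta$ is *critical* if $\alpha_k=\alpha_l$ for some $k,l\in\frac12\mathbb N$ with $l<k$. An $\mathfrak{spo}(2|2)$-equivariant quantization is a linear bijection $Q:\mathcal S_\delta\to\mathcal D_{\lambda\mu}$ such that $Q(S)\in\mathcal D^k_{\lambda\mu}$ has class $S$ for every $S\in\mathcal S^k_\delta$, and $\mathcal L_{X_f}\circ Q=Q\circ L_{X_f}$ for all $X_f\in\mathfrak{spo}(2|2)$.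 **Proposition.** Suppose $\delta$ is not critical, let $k\in\frac12+\mathbb N$ and $S\in\mathcal S^k_\delta$. There is a unique $\hat S=S_k+S_{k-\frac12}+S_{k-1}+\cdots+S_0$ with $S_j\in\mathcal S_\delta^j$, $S_k=S$ and $\mathcal C\hat S=\alpha_k\hat S$. The map $S\mapsto Q_{\rm Aff}(\hat S)$ on $\mathcal S^k_\delta$ commutes with the actions of $\mathfrak{spo}(2|2)$, and $Q(S)=Q_{\rm Aff}(\hat S)$ for every $\mathfrak{spo}(2|2)$-equivariant quantization $Q$. The components are as follows, where $A_j=-j$, $B_j=-(j+2\lambda)$. If $l$ is a natural number, $0\le l\le k-\frac12$, then $$S_{k-l}=\left[C'_l\begin{pmatrix}\partial_x^l&0\\0&\partial_x^l\end{pmatrix}+D'_l\begin{pmatrix}\partial_x^l&-\bar D_1\bar D_2\partial_x^{l-1}\\ \bar D_1\bar D_2\partial_x^{l-1}&\partial_x^l\end{pmatrix}\right]S_k,$$ $$C'_l=\frac{\prod_{i=0}^{l-1}A_{k-\frac12-i}B_{k-\frac12-i}}{\prod_{i=1}^l(\alpha_k-\alpha_{k-i})},\qquad D'_l=\frac{-l\prod_{i=0}^{l-1}A_{k-\frac12-i}B_{k-\frac12-i}}{2(\alpha_k-\alpha_{k-\frac12})\prod_{i=1}^l(\alpha_k-\alpha_{k-i})}$$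 (for $l=0$ the second term is absent, as $D'_0=0$). If $l\in\frac12+\mathbb N$, $l\le k$, then $$S_{k-l}=(-1)^{\tilde S_k+1}E'_l\left[\begin{pmatrix}B_{k-l}\bar D_1&B_{k-l}\bar D_2\\ A_{k-l}\bar D_2&-A_{k-l}\bar D_1\end{pmatrix}\partial_x^{\lfloor l\rfloor}\right]S_k,\qquad E'_l=\frac{\prod_{i=0}^{l-\frac32}A_{k-\frac12-i}B_{k-\frac12-i}}{2(\alpha_k-\alpha_{k-\frac12})\prod_{i=1}^{l-\frac12}(\alpha_k-\alpha_{k-i})},$$ in particular $E'_{\frac12}=\dfrac1{2(\alpha_k-\alpha_{k-\frac12})}$. -/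

import Mathlib

open scoped ContDiff DirectSum

noncomputable section

namespace SuperCircle

/-! ### Superfunctions on the supercircle, in the affine coordinate `x` -/

/-- Smooth complex-valued functions of the affine coordinate `x`. -/
def Smooth : Subalgebra ℂ (ℝ → ℂ) where
  carrier := {f | ContDiff ℝ ∞ f}
  mul_mem' := fun {f g} (hf : ContDiff ℝ ∞ f) (hg : ContDiff ℝ ∞ g) => hf.mul hg
  add_mem' := fun {f g} (hf : ContDiff ℝ ∞ f) (hg : ContDiff ℝ ∞ g) => hf.add hg
  algebraMap_mem' := fun c => (contDiff_const : ContDiff ℝ ∞ fun _ : ℝ => c)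

/-- The coordinate function `x`. -/
def coordX : Smooth := ⟨fun x => (x : ℂ), (Complex.ofRealCLM.contDiff : ContDiff ℝ ∞ _)⟩

/-- The derivative of a smooth function, as a linear map. -/
def derivSmooth : Smooth →ₗ[ℂ] Smooth where
  toFun f := ⟨deriv (f : ℝ → ℂ), (contDiff_infty_iff_deriv.1 f.2).2⟩
  map_add' f g := by
    ext x
    exact deriv_add ((contDiff_infty_iff_deriv.1 f.2).1 x) ((contDiff_infty_iff_deriv.1 g.2).1 x)
  map_smul' c f := by
    ext x
    exact deriv_const_smul c ((contDiff_infty_iff_deriv.1 f.2).1 x)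

/-- A superfunction `f₀ + θ₁ f₁ + θ₂ f₂ + θ₁ θ₂ f₁₂`. -/
@[ext]
structure SF where
  /-- the coefficient of `1` -/
  c0 : Smooth
  /-- the coefficient of `θ₁` -/
  c1 : Smooth
  /-- the coefficient of `θ₂` -/
  c2 : Smooth
  /-- the coefficient of `θ₁ θ₂` -/
  c12 : Smooth

namespace SF

instance : Zero SF := ⟨⟨0, 0, 0, 0⟩⟩
instance : Add SF := ⟨fun f g => ⟨f.c0 + g.c0, f.c1 + g.c1, f.c2 + g.c2, f.c12 + g.c12⟩⟩
instance : Neg SF := ⟨fun f => ⟨-f.c0, -f.c1, -f.c2, -f.c12⟩⟩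
instance : SMul ℂ SF := ⟨fun c f => ⟨c • f.c0, c • f.c1, c • f.c2, c • f.c12⟩⟩

@[simp] theorem zero_c0 : (0 : SF).c0 = 0 := rfl
@[simp] theorem zero_c1 : (0 : SF).c1 = 0 := rfl
@[simp] theorem zero_c2 : (0 : SF).c2 = 0 := rfl
@[simp] theorem zero_c12 : (0 : SF).c12 = 0 := rfl
@[simp] theorem add_c0 (f g : SF) : (f + g).c0 = f.c0 + g.c0 := rfl
@[simp] theorem add_c1 (f g : SF) : (f + g).c1 = f.c1 + g.c1 := rfl
@[simp] theorem add_c2 (f g : SF) : (f + g).c2 = f.c2 + g.c2 := rfl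
@[simp] theorem add_c12 (f g : SF) : (f + g).c12 = f.c12 + g.c12 := rfl
@[simp] theorem neg_c0 (f : SF) : (-f).c0 = -f.c0 := rfl
@[simp] theorem neg_c1 (f : SF) : (-f).c1 = -f.c1 := rfl
@[simp] theorem neg_c2 (f : SF) : (-f).c2 = -f.c2 := rfl
@[simp] theorem neg_c12 (f : SF) : (-f).c12 = -f.c12 := rfl
@[simp] theorem smul_c0 (c : ℂ) (f : SF) : (c • f).c0 = c • f.c0 := rfl
@[simp] theorem smul_c1 (c : ℂ) (f : SF) : (c • f).c1 = c • f.c1 := rfl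
@[simp] theorem smul_c2 (c : ℂ) (f : SF) : (c • f).c2 = c • f.c2 := rfl
@[simp] theorem smul_c12 (c : ℂ) (f : SF) : (c • f).c12 = c • f.c12 := rfl

instance : AddCommGroup SF where
  add_assoc f g h := by ext1 <;> simp [add_assoc]
  zero_add f := by ext1 <;> simp
  add_zero f := by ext1 <;> simp
  add_comm f g := by ext1 <;> simp [add_comm]
  neg_add_cancel f := by ext1 <;> simp
  nsmul := nsmulRec
  zsmul := zsmulRec

@[simp] theorem sub_c0 (f g : SF) : (f - g).c0 = f.c0 - g.c0 := (sub_eq_add_neg f.c0 g.c0).symm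
@[simp] theorem sub_c1 (f g : SF) : (f - g).c1 = f.c1 - g.c1 := (sub_eq_add_neg f.c1 g.c1).symm
@[simp] theorem sub_c2 (f g : SF) : (f - g).c2 = f.c2 - g.c2 := (sub_eq_add_neg f.c2 g.c2).symm
@[simp] theorem sub_c12 (f g : SF) : (f - g).c12 = f.c12 - g.c12 :=
  (sub_eq_add_neg f.c12 g.c12).symm

instance : Module ℂ SF where
  one_smul f := by ext1 <;> simp
  mul_smul a b f := by ext1 <;> simp [mul_smul]
  smul_zero a := by ext1 <;> simp
  smul_add a f g := by ext1 <;> simp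
  add_smul a b f := by ext1 <;> simp [add_smul]
  zero_smul f := by ext1 <;> simp

/-- The Grassmann product: `θ₁² = θ₂² = 0` and `θ₂ θ₁ = - θ₁ θ₂`. -/
instance : Mul SF := ⟨fun f g =>
  ⟨f.c0 * g.c0,
   f.c0 * g.c1 + f.c1 * g.c0,
   f.c0 * g.c2 + f.c2 * g.c0,
   f.c0 * g.c12 + f.c12 * g.c0 + f.c1 * g.c2 - f.c2 * g.c1⟩⟩

@[simp] theorem mul_c0 (f g : SF) : (f * g).c0 = f.c0 * g.c0 := rfl
@[simp] theorem mul_c1 (f g : SF) : (f * g).c1 = f.c0 * g.c1 + f.c1 * g.c0 := rfl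
@[simp] theorem mul_c2 (f g : SF) : (f * g).c2 = f.c0 * g.c2 + f.c2 * g.c0 := rfl
@[simp] theorem mul_c12 (f g : SF) :
    (f * g).c12 = f.c0 * g.c12 + f.c12 * g.c0 + f.c1 * g.c2 - f.c2 * g.c1 := rfl

end SF

/-- Linear endomorphisms of the space of superfunctions. -/
abbrev Op : Type := Module.End ℂ SF

/-- Left multiplication by a superfunction. -/
def mulL : SF →ₗ[ℂ] Op :=
  LinearMap.mk₂ ℂ (fun f g => f * g)
    (fun f f' g => by ext1 <;> simp <;> ring)
    (fun c f g => by ext1 <;> simp [smul_sub])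
    (fun f g g' => by ext1 <;> simp <;> ring)
    (fun c f g => by ext1 <;> simp [smul_sub])

/-- The even part of a superfunction. -/
def evenPart : Op where
  toFun f := ⟨f.c0, 0, 0, f.c12⟩
  map_add' f g := by ext1 <;> simp
  map_smul' c f := by ext1 <;> simp

/-- The odd part of a superfunction. -/
def oddPart : Op where
  toFun f := ⟨0, f.c1, f.c2, 0⟩
  map_add' f g := by ext1 <;> simp
  map_smul' c f := by ext1 <;> simp

/-- The parity involution: `par f = (-1)^|f| f` for homogeneous `f`. -/
def par : Op := evenPart - oddPart

/-- The odd coordinates. -/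
def theta1 : SF := ⟨0, 1, 0, 0⟩
/-- The odd coordinates. -/
def theta2 : SF := ⟨0, 0, 1, 0⟩

/-- The partial derivative with respect to `x`. -/
def dx : Op where
  toFun f := ⟨derivSmooth f.c0, derivSmooth f.c1, derivSmooth f.c2, derivSmooth f.c12⟩
  map_add' f g := by ext1 <;> simp
  map_smul' c f := by ext1 <;> simp

/-- The (left) partial derivative with respect to `θ₁`. -/
def dtheta1 : Op where
  toFun f := ⟨f.c1, 0, f.c12, 0⟩
  map_add' f g := by ext1 <;> simp
  map_smul' c f := by ext1 <;> simp

/-- The (left) partial derivative with respect to `θ₂`. -/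
def dtheta2 : Op where
  toFun f := ⟨f.c2, -f.c12, 0, 0⟩
  map_add' f g := by ext1 <;> simp [add_comm]
  map_smul' c f := by ext1 <;> simp

/-- The generators of the contact distribution. In `Op`, `*` is composition. -/
def Dbar1 : Op := dtheta1 - mulL theta1 * dx
/-- The generators of the contact distribution. -/
def Dbar2 : Op := dtheta2 - mulL theta2 * dx

/-! ### Contact vector fields, densities, the Lie superalgebra `spo(2|2)` -/

/-- The contact vector field `X_f = f ∂ₓ - (-1)^|f| (1/2) (D̄₁(f) D̄₁ + D̄₂(f) D̄₂)`. -/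
def contactField (f : SF) : Op :=
  mulL f * dx - (1 / 2 : ℂ) • (mulL (Dbar1 (par f)) * Dbar1 + mulL (Dbar2 (par f)) * Dbar2)

/-- The Lie derivative `X_f + w f'` of densities of weight `w`. -/
def lieDensity (w : ℂ) (f : SF) : Op := contactField f + w • mulL (dx f)

/-- Contact Hamiltonians `1, θ₁, θ₂, x, θ₁θ₂, xθ₁, xθ₂, x²` of a basis of `spo(2|2)`. -/
def spoBasis : Fin 8 → SF :=
  ![⟨1, 0, 0, 0⟩, theta1, theta2, ⟨coordX, 0, 0, 0⟩, ⟨0, 0, 0, 1⟩,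
    ⟨0, coordX, 0, 0⟩, ⟨0, 0, coordX, 0⟩, ⟨coordX ^ 2, 0, 0, 0⟩]

/-- The contact Hamiltonians of the elements of `spo(2|2)`. -/
def spo : Submodule ℂ SF := Submodule.span ℂ (Set.range spoBasis)

/-- Matrices in `gl(2|2)` corresponding, under the projective embedding
`spo(2|2) → Vect`, to the basis `X_1, X_θ₁, X_θ₂, X_x, X_θ₁θ₂, X_xθ₁, X_xθ₂, X_x²`.
The first two rows and columns are even. -/
def spoMatrix : Fin 8 → Matrix (Fin 4) (Fin 4) ℚ :=
  ![!![0, 0, 0, 0; -1, 0, 0, 0; 0, 0, 0, 0; 0, 0, 0, 0],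
    !![0, 0, 0, 0; 0, 0, 1 / 2, 0; -1 / 2, 0, 0, 0; 0, 0, 0, 0],
    !![0, 0, 0, 0; 0, 0, 0, 1 / 2; 0, 0, 0, 0; -1 / 2, 0, 0, 0],
    !![1 / 2, 0, 0, 0; 0, -1 / 2, 0, 0; 0, 0, 0, 0; 0, 0, 0, 0],
    !![0, 0, 0, 0; 0, 0, 0, 0; 0, 0, 0, 1 / 2; 0, 0, -1 / 2, 0],
    !![0, 0, -1 / 2, 0; 0, 0, 0, 0; 0, -1 / 2, 0, 0; 0, 0, 0, 0],
    !![0, 0, 0, -1 / 2; 0, 0, 0, 0; 0, 0, 0, 0; 0, -1 / 2, 0, 0],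
    !![0, 1, 0, 0; 0, 0, 0, 0; 0, 0, 0, 0; 0, 0, 0, 0]]

/-- The invariant form `K(A, B) = 2 str(AB)`. -/
def formK (A B : Matrix (Fin 4) (Fin 4) ℚ) : ℚ :=
  2 * ((A * B) 0 0 + (A * B) 1 1 - (A * B) 2 2 - (A * B) 3 3)

/-- The `K`-dual of the `i`-th basis element is `dualCoeff i` times the basis element of
index `dualIndex i`. -/
def dualIndex : Fin 8 → Fin 8 := ![7, 5, 6, 3, 4, 1, 2, 0]
/-- See `dualIndex`. -/
def dualCoeff : Fin 8 → ℚ := ![-1 / 2, -1, -1, 1, 1, 1, 1, -1 / 2]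

/-- `spoMatrix` and its dual family are `K`-dual bases. -/
theorem formK_dual (i j : Fin 8) :
    formK (spoMatrix i) (dualCoeff j • spoMatrix (dualIndex j)) = if i = j then 1 else 0 := by
  revert i j
  decide +kernel

/-- Contact Hamiltonians `-x²/2, -xθ₁, -xθ₂, x, θ₁θ₂, θ₁, θ₂, -1/2` of the `K`-dual basis. -/
def spoDualBasis (i : Fin 8) : SF := (dualCoeff i : ℂ) • spoBasis (dualIndex i)

/-! ### Differential operators -/

/-- Differential operators of order `< N / 2`: sums of `a ∂ₓˡ D̄₁ᵐ D̄₂ⁿ` with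
`l + m/2 + n/2 < N/2`. Thus order `≤ k` is `diffOpLT (2 k + 1)`. -/
def diffOpLT (N : ℕ) : Submodule ℂ Op :=
  Submodule.span ℂ {T | ∃ (a : SF) (l m n : ℕ),
    2 * l + m + n < N ∧ T = mulL a * dx ^ l * Dbar1 ^ m * Dbar2 ^ n}

/-- All differential operators. -/
def diffOp : Submodule ℂ Op := ⨆ N, diffOpLT N

/-- The Lie derivative `L^μ_f ∘ T - (-1)^(|f||T|) T ∘ L^λ_f` of an operator from
`λ`-densities to `μ`-densities; `par * T * par = (-1)^|T| T` for homogeneous `T`. -/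
def lieOp (lam mu : ℂ) (f : SF) (T : Op) : Op :=
  lieDensity mu f * T
    - (T * lieDensity lam (evenPart f) + par * T * par * lieDensity lam (oddPart f))

/-- The Casimir operator of `spo(2|2)` on operators from `λ`- to `μ`-densities,
relative to the form `K`. -/
def casimir (lam mu : ℂ) (T : Op) : Op :=
  ∑ i : Fin 8, lieOp lam mu (spoDualBasis i) (lieOp lam mu (spoBasis i) T)

/-! ### Symbols -/

/-- Symbols of degree `n / 2`, identified with pairs of superfunctions. In degree `0` there is
no second component (operators of order `0` are multiplications by a function). -/
def symbolSpace (n : ℕ) : Submodule ℂ (SF × SF) where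
  carrier := {F | n = 0 → F.2 = 0}
  add_mem' := fun {F G} hF hG h => by simp [hF h, hG h]
  zero_mem' := fun _ => rfl
  smul_mem' := fun c F hF h => by simp [hF h]

/-- The space of all symbols. -/
abbrev Symbols : Type := ⨁ n : ℕ, symbolSpace n

/-- The affine quantization of a pair, in degree `n / 2`. -/
def qAffPair (n : ℕ) : SF × SF →ₗ[ℂ] Op where
  toFun F :=
    if Even n then mulL F.1 * dx ^ (n / 2) + mulL F.2 * dx ^ (n / 2 - 1) * Dbar1 * Dbar2
    else mulL F.1 * dx ^ (n / 2) * Dbar1 + mulL F.2 * dx ^ (n / 2) * Dbar2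
  map_add' F G := by split_ifs <;> simp [add_mul] <;> abel
  map_smul' c F := by split_ifs <;> simp

/-- The affine quantization map. -/
def qAff : Symbols →ₗ[ℂ] Op :=
  DirectSum.toModule ℂ ℕ Op fun n => (qAffPair n).domRestrict (symbolSpace n)

/-- The Lie derivative of a symbol of degree `n / 2`, written on pairs. -/
def lieSymbolPair (del : ℂ) (n : ℕ) (f : SF) (F : SF × SF) : SF × SF :=
  if Even n then
    (lieDensity (del - n / 2) f F.1, lieDensity (del - n / 2) f F.2)
  else
    (lieDensity (del - n / 2) f F.1 - (1 / 2 : ℂ) • (Dbar1 (Dbar2 f) * F.2),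
     lieDensity (del - n / 2) f F.2 + (1 / 2 : ℂ) • (Dbar1 (Dbar2 f) * F.1))

/-- The Lie derivative of a symbol of degree `n / 2`. -/
def lieSymbol (del : ℂ) (n : ℕ) (f : SF) (F : symbolSpace n) : symbolSpace n :=
  ⟨lieSymbolPair del n f F.1, fun h => by
    have h2 := F.2 h
    subst h
    simp [lieSymbolPair, h2]⟩

/-- An `spo(2|2)`-equivariant quantization: a linear bijection from symbols to differential
operators which preserves the principal symbol (for `S` of degree `n / 2`, `Q S` is congruent to
the operator representing `S` modulo operators of order `< n / 2`) and intertwines the actions. -/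
def IsEquivariantQuantization (lam mu : ℂ) (Q : Symbols ≃ₗ[ℂ] diffOp) : Prop :=
  (∀ (n : ℕ) (S : symbolSpace n),
    (Q (DirectSum.lof ℂ ℕ (fun i => symbolSpace i) n S) : Op) - qAffPair n S ∈ diffOpLT n) ∧
  ∀ f ∈ spo, ∀ (n : ℕ) (S : symbolSpace n),
    lieOp lam mu f (Q (DirectSum.lof ℂ ℕ (fun i => symbolSpace i) n S)) =
      Q (DirectSum.lof ℂ ℕ (fun i => symbolSpace i) n (lieSymbol (mu - lam) n f S))

/-- The eigenvalue `α_k`, `k = n / 2`. -/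
def alpha (del : ℂ) (n : ℕ) : ℂ := (-(n / 2 : ℂ) + del) ^ 2 - if Even n then 0 else 1 / 4

/-- Critical values of `δ`. -/
def IsCritical (del : ℂ) : Prop := ∃ n m : ℕ, m < n ∧ alpha del n = alpha del m

/-- `Shat = S_k + S_{k-1/2} + ⋯ + S_0` with `S_k = S` is an eigenvector, for the eigenvalue `α_k`,
of the Casimir operator transported to symbols by the affine quantization map; `k = n / 2`. -/
def IsEigenLift (lam mu : ℂ) (n : ℕ) (S : symbolSpace n) (Shat : Symbols) : Prop :=
  (∀ m, n < m → Shat m = 0) ∧ Shat n = S ∧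
    casimir lam mu (qAff Shat) = alpha (mu - lam) n • qAff Shat

/-! ### The coefficients. Throughout `k = K + 1/2` with `K : ℕ`. -/

/-- `A_j = -j`. -/
def coeffA (j : ℕ) : ℂ := -(j : ℂ)

/-- `B_j = -(j + 2 λ)`. -/
def coeffB (lam : ℂ) (j : ℕ) : ℂ := -((j : ℂ) + 2 * lam)

/-- `C'_l = ∏_{i=0}^{l-1} A_{k-1/2-i} B_{k-1/2-i} / ∏_{i=1}^{l} (α_k - α_{k-i})`. -/
def coeffC (lam mu : ℂ) (K l : ℕ) : ℂ :=
  (∏ i ∈ Finset.range l, coeffA (K - i) * coeffB lam (K - i)) /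
    ∏ i ∈ Finset.Icc 1 l, (alpha (mu - lam) (2 * K + 1) - alpha (mu - lam) (2 * K + 1 - 2 * i))

/-- `D'_l`: `-l ∏_{i=0}^{l-1} A_{k-1/2-i} B_{k-1/2-i}` divided by
`2 (α_k - α_{k-1/2}) ∏_{i=1}^{l} (α_k - α_{k-i})`. -/
def coeffD (lam mu : ℂ) (K l : ℕ) : ℂ :=
  (-(l : ℂ) * ∏ i ∈ Finset.range l, coeffA (K - i) * coeffB lam (K - i)) /
    (2 * (alpha (mu - lam) (2 * K + 1) - alpha (mu - lam) (2 * K)) *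
      ∏ i ∈ Finset.Icc 1 l, (alpha (mu - lam) (2 * K + 1) - alpha (mu - lam) (2 * K + 1 - 2 * i)))

/-- `E'_l` for `l = p + 1/2`: `∏_{i=0}^{l-3/2} A_{k-1/2-i} B_{k-1/2-i}` divided by
`2 (α_k - α_{k-1/2}) ∏_{i=1}^{l-1/2} (α_k - α_{k-i})`. -/
def coeffE (lam mu : ℂ) (K p : ℕ) : ℂ :=
  (∏ i ∈ Finset.range p, coeffA (K - i) * coeffB lam (K - i)) /
    (2 * (alpha (mu - lam) (2 * K + 1) - alpha (mu - lam) (2 * K)) *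
      ∏ i ∈ Finset.Icc 1 p, (alpha (mu - lam) (2 * K + 1) - alpha (mu - lam) (2 * K + 1 - 2 * i)))

end SuperCircle

end

noncomputable section

namespace SuperCircle

set_option linter.unusedSimpArgs false
set_option linter.unusedTactic false
set_option linter.unreachableTactic false

/-! ### Componentwise calculus -/

namespace Smooth

/-! The affine quantization is equivariant for the affine subalgebra spanned by `X_f` with `f = 1,
θ₁, θ₂, x, θ₁θ₂`. For the other three generators its failure to be equivariant is explicit
(`lieOp_qAffPair`): `X_f` acts on a symbol of degree `n / 2` by the symbol action, plus a term
lowering the degree by `1 / 2` and governed by `D̄ᵢ(f')`, plus a term lowering it by `1` and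
governed by `f''`. In every dual pair of the Casimir operator one element is affine, so corrections
never multiply each other. On pure symbols the Casimir operator is the scalar `α`
(`casimir_symbol`). Altogether it is triangular on symbols, with diagonal `α` and two strictly lower
parts: one with the coefficients of the half-step correction and built from `D̄₁, D̄₂`, the other
with those of the full-step correction and built from `∂ₓ` (`casimir_qAffPair`).

Since `qAff` is injective, the eigenvector equation splits into the recursion `(α_n - α_j) s_j =
corr (s_{j+1}) + corrTwo (s_{j+2})` (`casimir_sum_eq_iff`). For non-critical `δ` the factors on the
left are nonzero below the top degree, so the top term determines the rest (`IsEigenSeq.eq`). The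
closed formulas are verified to satisfy this recursion (`isEigenSeq_liftSeq`), which gives
existence.

The remaining claims follow from uniqueness in the form `eq_qAff_of_casimir_eq`. An equivariant
quantization carries the scalar `α_n` on symbols to the Casimir operator on its values, so `Q(S)` is
an eigenvector with principal symbol `S`. The Casimir operator commutes with `spo(2|2)`
(`casimir_lieOp`), so applying `X_f` to the lift of `S` yields an eigenvector with principal symbol
`L_{X_f} S`, which must be the lift of that symbol. -/

@[simp] theorem coe_mul_apply (f g : Smooth) (x : ℝ) : (f * g : Smooth).1 x = f.1 x * g.1 x := rfl
@[simp] theorem coe_add_apply (f g : Smooth) (x : ℝ) : (f + g : Smooth).1 x = f.1 x + g.1 x := rfl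
@[simp] theorem coe_sub_apply (f g : Smooth) (x : ℝ) : (f - g : Smooth).1 x = f.1 x - g.1 x := rfl
@[simp] theorem coe_neg_apply (f : Smooth) (x : ℝ) : (-f : Smooth).1 x = -f.1 x := rfl
@[simp] theorem coe_smul_apply (c : ℂ) (f : Smooth) (x : ℝ) :
    (c • f : Smooth).1 x = c * f.1 x := rfl
@[simp] theorem coe_zero_apply (x : ℝ) : (0 : Smooth).1 x = 0 := rfl
@[simp] theorem coe_one_apply (x : ℝ) : (1 : Smooth).1 x = 1 := rfl
theorem ext' {f g : Smooth} (h : ∀ x, f.1 x = g.1 x) : f = g := Subtype.ext (funext h)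

/-! Instances of algebraic identities, stated without type class arguments. -/

protected theorem mul_add (a b c : Smooth) : a * (b + c) = a * b + a * c := _root_.mul_add a b c
protected theorem mul_sub (a b c : Smooth) : a * (b - c) = a * b - a * c := _root_.mul_sub a b c
protected theorem mul_neg (a b : Smooth) : a * -b = -(a * b) := _root_.mul_neg a b
protected theorem mul_smul (c : ℂ) (a b : Smooth) : a * c • b = c • (a * b) :=
  mul_smul_comm c a b
protected theorem mul_zero (a : Smooth) : a * 0 = 0 := MulZeroClass.mul_zero a
protected theorem zero_mul (a : Smooth) : 0 * a = 0 := MulZeroClass.zero_mul a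
protected theorem mul_one (a : Smooth) : a * 1 = a := _root_.mul_one a
protected theorem one_mul (a : Smooth) : 1 * a = a := _root_.one_mul a
protected theorem smul_zero (c : ℂ) : c • (0 : Smooth) = 0 := _root_.smul_zero c
protected theorem add_zero (a : Smooth) : a + 0 = a := _root_.add_zero a
protected theorem zero_add (a : Smooth) : 0 + a = a := _root_.zero_add a
protected theorem sub_zero (a : Smooth) : a - 0 = a := _root_.sub_zero a
protected theorem neg_zero : -(0 : Smooth) = 0 := _root_.neg_zero
protected theorem map_add (T : Module.End ℂ Smooth) (a b : Smooth) : T (a + b) = T a + T b :=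
  T.map_add a b
protected theorem map_sub (T : Module.End ℂ Smooth) (a b : Smooth) : T (a - b) = T a - T b :=
  T.map_sub a b
protected theorem map_neg (T : Module.End ℂ Smooth) (a : Smooth) : T (-a) = -T a := T.map_neg a
protected theorem map_smul (T : Module.End ℂ Smooth) (c : ℂ) (a : Smooth) : T (c • a) = c • T a :=
  T.map_smul c a
protected theorem map_zero (T : Module.End ℂ Smooth) : T 0 = 0 := T.map_zero
protected theorem pow_zero_apply (T : Module.End ℂ Smooth) (a : Smooth) : (T ^ 0) a = a := rfl
protected theorem pow_one_apply (T : Module.End ℂ Smooth) (a : Smooth) : (T ^ 1) a = T a := by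
  rw [pow_one]

end Smooth

/-! ### Derivatives of smooth functions and of their products with powers of `x`. -/

@[simp] theorem derivSmooth_mul (f g : Smooth) :
    derivSmooth (f * g) = derivSmooth f * g + f * derivSmooth g := by
  apply Smooth.ext'
  intro x
  exact deriv_mul ((contDiff_infty_iff_deriv.1 f.2).1 x) ((contDiff_infty_iff_deriv.1 g.2).1 x)

@[simp] theorem derivSmooth_one : derivSmooth 1 = 0 := by
  apply Smooth.ext'
  intro x
  exact deriv_const x (1 : ℂ)

@[simp] theorem derivSmooth_coordX : derivSmooth coordX = 1 := by
  apply Smooth.ext'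
  intro x
  exact (Complex.ofRealCLM.hasDerivAt (x := x)).deriv.trans Complex.ofReal_one

@[simp] theorem derivSmooth_pow_comm (k : ℕ) (f : Smooth) :
    (derivSmooth ^ k) (derivSmooth f) = derivSmooth ((derivSmooth ^ k) f) := by
  rw [← Module.End.mul_apply, ← Module.End.mul_apply, ← pow_succ, ← pow_succ']

@[simp] theorem derivSmooth_pow_succ (k : ℕ) (f : Smooth) :
    (derivSmooth ^ (k + 1)) f = derivSmooth ((derivSmooth ^ k) f) := by
  rw [pow_succ', Module.End.mul_apply]

/-- The Leibniz rule stops after two terms since `x'' = 0`. The order `k + 1` is written as one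
derivative after `k` to match the normal form produced by `derivSmooth_pow_succ`, and to avoid an
exponent `k - 1`. -/
theorem derivSmooth_pow_coordX_mul (k : ℕ) (f : Smooth) :
    derivSmooth ((derivSmooth ^ k) (coordX * f)) =
      coordX * derivSmooth ((derivSmooth ^ k) f) + ((k : ℂ) + 1) • (derivSmooth ^ k) f := by
  induction k with
  | zero => simp [derivSmooth_mul, derivSmooth_coordX]; ring
  | succ k ih =>
    rw [derivSmooth_pow_succ, ih, map_add, derivSmooth_mul, derivSmooth_coordX, map_smul,
      derivSmooth_pow_succ]
    apply Smooth.ext'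
    intro x
    simp only [Smooth.coe_mul_apply, Smooth.coe_add_apply, Smooth.coe_smul_apply,
      Smooth.coe_one_apply]
    push_cast
    ring

/-- Leibniz for `∂^(k+1) (x² g)` ends with a multiple of `∂^(k-1) g`. With `g = f'`, the only case
occurring for `X_{x²}`, this is `∂^k f`, and no subtraction in the exponent is needed. -/
theorem derivSmooth_pow_coordX_sq_mul (k : ℕ) (f : Smooth) :
    derivSmooth ((derivSmooth ^ k) (coordX * (coordX * derivSmooth f))) =
      coordX * (coordX * derivSmooth (derivSmooth ((derivSmooth ^ k) f))) +
        (2 * ((k : ℂ) + 1)) • (coordX * derivSmooth ((derivSmooth ^ k) f)) +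
        (((k : ℂ) + 1) * k) • (derivSmooth ^ k) f := by
  rw [derivSmooth_pow_coordX_mul]
  cases k with
  | zero =>
    simp [derivSmooth_mul, derivSmooth_coordX]
    apply Smooth.ext'
    intro x
    simp only [Smooth.coe_mul_apply, Smooth.coe_add_apply, Smooth.coe_smul_apply]
    ring
  | succ k =>
    simp only [derivSmooth_pow_succ, derivSmooth_pow_coordX_mul, derivSmooth_mul, map_add,
      derivSmooth_coordX, map_smul, derivSmooth_pow_comm]
    apply Smooth.ext'
    intro x
    simp only [Smooth.coe_mul_apply, Smooth.coe_add_apply, Smooth.coe_smul_apply,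
      Smooth.coe_one_apply]
    push_cast
    ring

section Components
variable (f g : SF)

@[simp] theorem mulL_apply : mulL f g = f * g := rfl
@[simp] theorem dx_c0 : (dx f).c0 = derivSmooth f.c0 := rfl
@[simp] theorem dx_c1 : (dx f).c1 = derivSmooth f.c1 := rfl
@[simp] theorem dx_c2 : (dx f).c2 = derivSmooth f.c2 := rfl
@[simp] theorem dx_c12 : (dx f).c12 = derivSmooth f.c12 := rfl
@[simp] theorem dtheta1_c0 : (dtheta1 f).c0 = f.c1 := rfl
@[simp] theorem dtheta1_c1 : (dtheta1 f).c1 = 0 := rfl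
@[simp] theorem dtheta1_c2 : (dtheta1 f).c2 = f.c12 := rfl
@[simp] theorem dtheta1_c12 : (dtheta1 f).c12 = 0 := rfl
@[simp] theorem dtheta2_c0 : (dtheta2 f).c0 = f.c2 := rfl
@[simp] theorem dtheta2_c1 : (dtheta2 f).c1 = -f.c12 := rfl
@[simp] theorem dtheta2_c2 : (dtheta2 f).c2 = 0 := rfl
@[simp] theorem dtheta2_c12 : (dtheta2 f).c12 = 0 := rfl
@[simp] theorem evenPart_c0 : (evenPart f).c0 = f.c0 := rfl
@[simp] theorem evenPart_c1 : (evenPart f).c1 = 0 := rfl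
@[simp] theorem evenPart_c2 : (evenPart f).c2 = 0 := rfl
@[simp] theorem evenPart_c12 : (evenPart f).c12 = f.c12 := rfl
@[simp] theorem oddPart_c0 : (oddPart f).c0 = 0 := rfl
@[simp] theorem oddPart_c1 : (oddPart f).c1 = f.c1 := rfl
@[simp] theorem oddPart_c2 : (oddPart f).c2 = f.c2 := rfl
@[simp] theorem oddPart_c12 : (oddPart f).c12 = 0 := rfl
@[simp] theorem par_c0 : (par f).c0 = f.c0 := by simp [par]
@[simp] theorem par_c1 : (par f).c1 = -f.c1 := by simp [par]
@[simp] theorem par_c2 : (par f).c2 = -f.c2 := by simp [par]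
@[simp] theorem par_c12 : (par f).c12 = f.c12 := by simp [par]
@[simp] theorem theta1_c0 : theta1.c0 = 0 := rfl
@[simp] theorem theta1_c1 : theta1.c1 = 1 := rfl
@[simp] theorem theta1_c2 : theta1.c2 = 0 := rfl
@[simp] theorem theta1_c12 : theta1.c12 = 0 := rfl
@[simp] theorem theta2_c0 : theta2.c0 = 0 := rfl
@[simp] theorem theta2_c1 : theta2.c1 = 0 := rfl
@[simp] theorem theta2_c2 : theta2.c2 = 1 := rfl
@[simp] theorem theta2_c12 : theta2.c12 = 0 := rfl
@[simp] theorem Dbar1_c0 : (Dbar1 f).c0 = f.c1 := by simp [Dbar1]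
@[simp] theorem Dbar1_c1 : (Dbar1 f).c1 = -derivSmooth f.c0 := by simp [Dbar1]
@[simp] theorem Dbar1_c2 : (Dbar1 f).c2 = f.c12 := by simp [Dbar1]
@[simp] theorem Dbar1_c12 : (Dbar1 f).c12 = -derivSmooth f.c2 := by simp [Dbar1]
@[simp] theorem Dbar2_c0 : (Dbar2 f).c0 = f.c2 := by simp [Dbar2]
@[simp] theorem Dbar2_c1 : (Dbar2 f).c1 = -f.c12 := by simp [Dbar2]
@[simp] theorem Dbar2_c2 : (Dbar2 f).c2 = -derivSmooth f.c0 := by simp [Dbar2]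
@[simp] theorem Dbar2_c12 : (Dbar2 f).c12 = derivSmooth f.c1 := by simp [Dbar2]

@[simp] theorem dx_pow_c0 (k : ℕ) : ((dx ^ k) f).c0 = (derivSmooth ^ k) f.c0 := by
  induction k with
  | zero => rfl
  | succ k ih => rw [pow_succ', pow_succ', Module.End.mul_apply, Module.End.mul_apply, dx_c0, ih]
@[simp] theorem dx_pow_c1 (k : ℕ) : ((dx ^ k) f).c1 = (derivSmooth ^ k) f.c1 := by
  induction k with
  | zero => rfl
  | succ k ih => rw [pow_succ', pow_succ', Module.End.mul_apply, Module.End.mul_apply, dx_c1, ih]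
@[simp] theorem dx_pow_c2 (k : ℕ) : ((dx ^ k) f).c2 = (derivSmooth ^ k) f.c2 := by
  induction k with
  | zero => rfl
  | succ k ih => rw [pow_succ', pow_succ', Module.End.mul_apply, Module.End.mul_apply, dx_c2, ih]
@[simp] theorem dx_pow_c12 (k : ℕ) : ((dx ^ k) f).c12 = (derivSmooth ^ k) f.c12 := by
  induction k with
  | zero => rfl
  | succ k ih => rw [pow_succ', pow_succ', Module.End.mul_apply, Module.End.mul_apply, dx_c12, ih]

theorem lieDensity_apply (w : ℂ) : lieDensity w f g = f * dx g -
    (1 / 2 : ℂ) • (Dbar1 (par f) * Dbar1 g + Dbar2 (par f) * Dbar2 g) + w • (dx f * g) := rfl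

theorem lieOp_apply (lam mu : ℂ) (T : Op) : lieOp lam mu f T g = lieDensity mu f (T g) -
    (T (lieDensity lam (evenPart f) g) + par (T (par (lieDensity lam (oddPart f) g)))) := rfl

theorem sf_ext {f g : SF} (h0 : ∀ x, f.c0.1 x = g.c0.1 x) (h1 : ∀ x, f.c1.1 x = g.c1.1 x)
    (h2 : ∀ x, f.c2.1 x = g.c2.1 x) (h12 : ∀ x, f.c12.1 x = g.c12.1 x) : f = g :=
  SF.ext (Smooth.ext' h0) (Smooth.ext' h1) (Smooth.ext' h2) (Smooth.ext' h12)

end Components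

theorem eq_of_evenPart_eq_zero {f : SF} (hf : evenPart f = 0) : f = ⟨0, f.c1, f.c2, 0⟩ :=
  SF.ext (congrArg SF.c0 hf : f.c0 = 0) rfl rfl (congrArg SF.c12 hf : f.c12 = 0)

theorem eq_of_oddPart_eq_zero {f : SF} (hf : oddPart f = 0) : f = ⟨f.c0, 0, 0, f.c12⟩ :=
  SF.ext rfl (congrArg SF.c1 hf : f.c1 = 0) (congrArg SF.c2 hf : f.c2 = 0) rfl

/-- For homogeneous `f` the sign `(-1)^|f|` is fixed and half of the components vanish. This reduces
later identities between operators to commutative ring identities in each component. -/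
theorem lieDensity_odd (w : ℂ) {f : SF} (hf : evenPart f = 0) (g : SF) : lieDensity w f g =
    ⟨(1 / 2 : ℂ) • (f.c1 * g.c1 + f.c2 * g.c2),
     (1 / 2 : ℂ) • (f.c1 * derivSmooth g.c0 - f.c2 * g.c12) + w • (derivSmooth f.c1 * g.c0),
     (1 / 2 : ℂ) • (f.c2 * derivSmooth g.c0 + f.c1 * g.c12) + w • (derivSmooth f.c2 * g.c0),
     (1 / 2 : ℂ) • (f.c1 * derivSmooth g.c2 - f.c2 * derivSmooth g.c1) +
       (w + 1 / 2) • (derivSmooth f.c1 * g.c2 - derivSmooth f.c2 * g.c1)⟩ := by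
  rw [eq_of_evenPart_eq_zero hf]
  apply sf_ext <;> intro x <;> simp [lieDensity_apply] <;> ring

theorem lieDensity_even (w : ℂ) {f : SF} (hf : oddPart f = 0) (g : SF) : lieDensity w f g =
    ⟨f.c0 * derivSmooth g.c0 + w • (derivSmooth f.c0 * g.c0),
     f.c0 * derivSmooth g.c1 + (w + 1 / 2) • (derivSmooth f.c0 * g.c1) +
       (1 / 2 : ℂ) • (f.c12 * g.c2),
     f.c0 * derivSmooth g.c2 + (w + 1 / 2) • (derivSmooth f.c0 * g.c2) -
       (1 / 2 : ℂ) • (f.c12 * g.c1),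
     f.c0 * derivSmooth g.c12 + (w + 1) • (derivSmooth f.c0 * g.c12) +
       w • (derivSmooth f.c12 * g.c0)⟩ := by
  rw [eq_of_oddPart_eq_zero hf]
  apply sf_ext <;> intro x <;> simp [lieDensity_apply] <;> ring

/-! ### The basis Hamiltonians of `spo(2|2)` and their action in components. -/

section Basis

theorem spoBasis_0 : spoBasis 0 = ⟨1, 0, 0, 0⟩ := rfl
theorem spoBasis_1 : spoBasis 1 = ⟨0, 1, 0, 0⟩ := rfl
theorem spoBasis_2 : spoBasis 2 = ⟨0, 0, 1, 0⟩ := rfl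
theorem spoBasis_3 : spoBasis 3 = ⟨coordX, 0, 0, 0⟩ := rfl
theorem spoBasis_4 : spoBasis 4 = ⟨0, 0, 0, 1⟩ := rfl
theorem spoBasis_5 : spoBasis 5 = ⟨0, coordX, 0, 0⟩ := rfl
theorem spoBasis_6 : spoBasis 6 = ⟨0, 0, coordX, 0⟩ := rfl
theorem spoBasis_7 : spoBasis 7 = ⟨coordX * coordX, 0, 0, 0⟩ := by
  rw [← pow_two]; rfl

theorem lieDensity_spoBasis_0 (w : ℂ) (g : SF) : lieDensity w (spoBasis 0) g =
    ⟨derivSmooth g.c0,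
     derivSmooth g.c1,
     derivSmooth g.c2,
     derivSmooth g.c12⟩ := by
  rw [lieDensity_even w rfl, spoBasis_0]
  apply sf_ext <;> intro x <;> simp

theorem lieDensity_spoBasis_1 (w : ℂ) (g : SF) : lieDensity w (spoBasis 1) g =
    ⟨(1 / 2 : ℂ) • g.c1,
     (1 / 2 : ℂ) • derivSmooth g.c0,
     (1 / 2 : ℂ) • g.c12,
     (1 / 2 : ℂ) • derivSmooth g.c2⟩ := by
  rw [lieDensity_odd w rfl, spoBasis_1]
  apply sf_ext <;> intro x <;> simp

theorem lieDensity_spoBasis_2 (w : ℂ) (g : SF) : lieDensity w (spoBasis 2) g =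
    ⟨(1 / 2 : ℂ) • g.c2,
     -((1 / 2 : ℂ) • g.c12),
     (1 / 2 : ℂ) • derivSmooth g.c0,
     -((1 / 2 : ℂ) • derivSmooth g.c1)⟩ := by
  rw [lieDensity_odd w rfl, spoBasis_2]
  apply sf_ext <;> intro x <;> simp

theorem lieDensity_spoBasis_3 (w : ℂ) (g : SF) : lieDensity w (spoBasis 3) g =
    ⟨coordX * derivSmooth g.c0 + w • g.c0,
     coordX * derivSmooth g.c1 + (w + 1 / 2) • g.c1,
     coordX * derivSmooth g.c2 + (w + 1 / 2) • g.c2,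
     coordX * derivSmooth g.c12 + (w + 1) • g.c12⟩ := by
  rw [lieDensity_even w rfl, spoBasis_3]
  apply sf_ext <;> intro x <;> simp

theorem lieDensity_spoBasis_4 (w : ℂ) (g : SF) : lieDensity w (spoBasis 4) g =
    ⟨0,
     (1 / 2 : ℂ) • g.c2,
     -((1 / 2 : ℂ) • g.c1),
     0⟩ := by
  rw [lieDensity_even w rfl, spoBasis_4]
  apply sf_ext <;> intro x <;> simp

theorem lieDensity_spoBasis_5 (w : ℂ) (g : SF) : lieDensity w (spoBasis 5) g =
    ⟨(1 / 2 : ℂ) • (coordX * g.c1),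
     (1 / 2 : ℂ) • (coordX * derivSmooth g.c0) + w • g.c0,
     (1 / 2 : ℂ) • (coordX * g.c12),
     (1 / 2 : ℂ) • (coordX * derivSmooth g.c2) + (w + 1 / 2) • g.c2⟩ := by
  rw [lieDensity_odd w rfl, spoBasis_5]
  apply sf_ext <;> intro x <;> simp

theorem lieDensity_spoBasis_6 (w : ℂ) (g : SF) : lieDensity w (spoBasis 6) g =
    ⟨(1 / 2 : ℂ) • (coordX * g.c2),
     -((1 / 2 : ℂ) • (coordX * g.c12)),
     (1 / 2 : ℂ) • (coordX * derivSmooth g.c0) + w • g.c0,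
     -((1 / 2 : ℂ) • (coordX * derivSmooth g.c1) + (w + 1 / 2) • g.c1)⟩ := by
  rw [lieDensity_odd w rfl, spoBasis_6]
  apply sf_ext <;> intro x <;> simp
  ring

theorem lieDensity_spoBasis_7 (w : ℂ) (g : SF) : lieDensity w (spoBasis 7) g =
    ⟨coordX * (coordX * derivSmooth g.c0) + (2 * w) • (coordX * g.c0),
     coordX * (coordX * derivSmooth g.c1) + (2 * w + 1) • (coordX * g.c1),
     coordX * (coordX * derivSmooth g.c2) + (2 * w + 1) • (coordX * g.c2),
     coordX * (coordX * derivSmooth g.c12) + (2 * w + 2) • (coordX * g.c12)⟩ := by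
  rw [lieDensity_even w rfl, spoBasis_7]
  apply sf_ext <;> intro x <;> simp <;> ring

theorem lieDensity_zero (w : ℂ) : lieDensity w 0 = 0 := by
  simp [lieDensity, contactField]

theorem evenPart_spoBasis_0 : evenPart (spoBasis 0) = spoBasis 0 := rfl
theorem oddPart_spoBasis_0 : oddPart (spoBasis 0) = 0 := rfl
theorem evenPart_spoBasis_1 : evenPart (spoBasis 1) = 0 := rfl
theorem oddPart_spoBasis_1 : oddPart (spoBasis 1) = spoBasis 1 := rfl
theorem evenPart_spoBasis_2 : evenPart (spoBasis 2) = 0 := rfl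
theorem oddPart_spoBasis_2 : oddPart (spoBasis 2) = spoBasis 2 := rfl
theorem evenPart_spoBasis_3 : evenPart (spoBasis 3) = spoBasis 3 := rfl
theorem oddPart_spoBasis_3 : oddPart (spoBasis 3) = 0 := rfl
theorem evenPart_spoBasis_4 : evenPart (spoBasis 4) = spoBasis 4 := rfl
theorem oddPart_spoBasis_4 : oddPart (spoBasis 4) = 0 := rfl
theorem evenPart_spoBasis_5 : evenPart (spoBasis 5) = 0 := rfl
theorem oddPart_spoBasis_5 : oddPart (spoBasis 5) = spoBasis 5 := rfl
theorem evenPart_spoBasis_6 : evenPart (spoBasis 6) = 0 := rfl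
theorem oddPart_spoBasis_6 : oddPart (spoBasis 6) = spoBasis 6 := rfl
theorem evenPart_spoBasis_7 : evenPart (spoBasis 7) = spoBasis 7 := rfl
theorem oddPart_spoBasis_7 : oddPart (spoBasis 7) = 0 := rfl

theorem spoBasis_index_cases (i : Fin 8) :
    i = 0 ∨ i = 1 ∨ i = 2 ∨ i = 3 ∨ i = 4 ∨ i = 5 ∨ i = 6 ∨ i = 7 := by
  revert i; decide

end Basis

/-! ### The affine quantization applied to a superfunction. -/

theorem qAffPair_even (k : ℕ) (F : SF × SF) (g : SF) : qAffPair (2 * k) F g =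
    F.1 * (dx ^ k) g + F.2 * (dx ^ (k - 1)) (Dbar1 (Dbar2 g)) := by
  simp [qAffPair]

theorem qAffPair_odd (k : ℕ) (F : SF × SF) (g : SF) : qAffPair (2 * k + 1) F g =
    F.1 * (dx ^ k) (Dbar1 g) + F.2 * (dx ^ k) (Dbar2 g) := by
  have h : (2 * k + 1) / 2 = k := by omega
  simp [qAffPair, h]

/-! ### The failure of the affine quantization to be equivariant -/

/-- First-order (in half-integer steps) corrections built from two odd operators. -/
def corr (lam : ℂ) (n : ℕ) (u v : Op) (F : SF × SF) : SF × SF :=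
  if Even n then
    ((coeffA (n / 2) / 2) • u (par F.1) + (coeffB lam (n / 2) / 2) • v (par F.2),
     (coeffA (n / 2) / 2) • v (par F.1) - (coeffB lam (n / 2) / 2) • u (par F.2))
  else
    (-(coeffB lam (n / 2) / 2) • (u (par F.1) + v (par F.2)),
     -(coeffA (n / 2) / 2) • (v (par F.1) - u (par F.2)))

/-- Second-order corrections built from an even operator. -/
def corrTwo (lam : ℂ) (n : ℕ) (u : Op) (F : SF × SF) : SF × SF :=
  if Even n then
    ((coeffA (n / 2) * coeffB lam (n / 2 - 1)) • u F.1,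
     (coeffA (n / 2 - 1) * coeffB lam (n / 2)) • u F.2)
  else
    ((coeffA (n / 2) * coeffB lam (n / 2)) • u F.1, (coeffA (n / 2) * coeffB lam (n / 2)) • u F.2)

/-- The correction of order `1 / 2` to the action of the contact Hamiltonian `f`. -/
def corrOne (lam : ℂ) (n : ℕ) (f : SF) (F : SF × SF) : SF × SF :=
  corr lam n (-mulL (Dbar1 (dx (par f)))) (-mulL (Dbar2 (dx (par f)))) F

set_option maxHeartbeats 20000000 in
-- The hypothesis on `F.2` cannot be dropped: the exponent `0 - 1` is truncated to `0`, so a nonzero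
-- `F.2` would contribute the first-order operator `F.2 D̄₁ D̄₂`. Multiplication operators leave no
-- room for corrections.
theorem lieOp_qAffPair_zero (lam mu : ℂ) (i : Fin 8) (F : SF × SF) (hF : F.2 = 0) :
    lieOp lam mu (spoBasis i) (qAffPair (2 * 0) F) =
      qAffPair (2 * 0) (lieSymbolPair (mu - lam) (2 * 0) (spoBasis i) F) := by
  have e : (2 * 0) / 2 = 0 := by omega
  have e' : Even (2 * 0) := even_two_mul _
  obtain ⟨F, F'⟩ := F
  obtain rfl : F' = 0 := hF
  apply LinearMap.ext
  intro g
  simp only [LinearMap.add_apply, lieOp_apply, qAffPair_even, qAffPair_odd, corrOne, corr, corrTwo,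
    lieSymbolPair, e, e', if_true, if_false, Nat.add_sub_cancel, coeffA, coeffB]
  obtain ⟨a0, a1, a2, a3⟩ := F
  obtain ⟨g0, g1, g2, g3⟩ := g
  rcases spoBasis_index_cases i with rfl | rfl | rfl | rfl | rfl | rfl | rfl | rfl
  all_goals
    simp only [
      lieDensity_spoBasis_0, lieDensity_spoBasis_1, lieDensity_spoBasis_2,
      lieDensity_spoBasis_3, lieDensity_spoBasis_4, lieDensity_spoBasis_5,
      lieDensity_spoBasis_6, lieDensity_spoBasis_7, evenPart_spoBasis_0,
      evenPart_spoBasis_1, evenPart_spoBasis_2, evenPart_spoBasis_3, evenPart_spoBasis_4,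
      evenPart_spoBasis_5, evenPart_spoBasis_6, evenPart_spoBasis_7, oddPart_spoBasis_0,
      oddPart_spoBasis_1, oddPart_spoBasis_2, oddPart_spoBasis_3, oddPart_spoBasis_4,
      oddPart_spoBasis_5, oddPart_spoBasis_6, oddPart_spoBasis_7, lieDensity_zero,
      LinearMap.zero_apply]
    try simp only [
      spoBasis_0, spoBasis_1, spoBasis_2, spoBasis_3, spoBasis_4, spoBasis_5, spoBasis_6,
      spoBasis_7]
    ext1
  all_goals
    simp only [
      SF.mul_c0, SF.mul_c1, SF.mul_c2, SF.mul_c12, SF.add_c0, SF.add_c1, SF.add_c2,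
      SF.add_c12, SF.sub_c0, SF.sub_c1, SF.sub_c2, SF.sub_c12, SF.smul_c0, SF.smul_c1,
      SF.smul_c2, SF.smul_c12, SF.neg_c0, SF.neg_c1, SF.neg_c2, SF.neg_c12, dx_c0, dx_c1,
      dx_c2, dx_c12, dx_pow_c0, dx_pow_c1, dx_pow_c2, dx_pow_c12, Dbar1_c0, Dbar1_c1,
      Dbar1_c2, Dbar1_c12, Dbar2_c0, Dbar2_c1, Dbar2_c2, Dbar2_c12, par_c0, par_c1, par_c2,
      par_c12, theta1_c0, theta1_c1, theta1_c2, theta1_c12, theta2_c0, theta2_c1, theta2_c2,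
      theta2_c12, SF.zero_c0, SF.zero_c1, SF.zero_c2, SF.zero_c12, LinearMap.neg_apply,
      LinearMap.smul_apply, mulL_apply, derivSmooth_mul, derivSmooth_coordX,
      derivSmooth_one, derivSmooth_pow_succ, derivSmooth_pow_comm, Smooth.map_add,
      Smooth.map_neg, Smooth.map_sub, Smooth.map_smul, Smooth.map_zero, Smooth.mul_add,
      Smooth.mul_neg, Smooth.mul_sub, Smooth.mul_smul, Smooth.mul_zero, Smooth.zero_mul,
      Smooth.mul_one, Smooth.one_mul, Smooth.smul_zero, Smooth.add_zero, Smooth.zero_add,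
      Smooth.sub_zero, Smooth.neg_zero, Smooth.pow_zero_apply, Smooth.pow_one_apply,
      derivSmooth_pow_coordX_sq_mul, Nat.add_sub_cancel, zero_add, Nat.cast_zero]
    try simp only [
      derivSmooth_pow_comm, derivSmooth_pow_coordX_mul, derivSmooth_mul, derivSmooth_coordX,
      derivSmooth_one, Smooth.map_add, Smooth.map_neg, Smooth.map_sub, Smooth.map_smul,
      Smooth.map_zero, Smooth.one_mul]
  all_goals
    apply Smooth.ext'
    intro x
    simp only [
      Smooth.coe_mul_apply, Smooth.coe_add_apply, Smooth.coe_smul_apply,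
      Smooth.coe_one_apply, Smooth.coe_sub_apply, Smooth.coe_neg_apply,
      Smooth.coe_zero_apply]
    try push_cast
    try ring1

set_option maxHeartbeats 20000000 in
theorem lieOp_qAffPair_one (lam mu : ℂ) (i : Fin 8) (F : SF × SF) :
    lieOp lam mu (spoBasis i) (qAffPair (2 * 0 + 1) F) =
      qAffPair (2 * 0 + 1) (lieSymbolPair (mu - lam) (2 * 0 + 1) (spoBasis i) F) +
      qAffPair (2 * 0) (corrOne lam (2 * 0 + 1) (spoBasis i) F) := by
  have e : (2 * 0 + 1) / 2 = 0 := by omega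
  have e' : ¬ Even (2 * 0 + 1) := by simp
  apply LinearMap.ext
  intro g
  simp only [LinearMap.add_apply, lieOp_apply, qAffPair_even, qAffPair_odd, corrOne, corr, corrTwo,
    lieSymbolPair, e, e', if_true, if_false, Nat.add_sub_cancel, coeffA, coeffB]
  obtain ⟨⟨a0, a1, a2, a3⟩, ⟨b0, b1, b2, b3⟩⟩ := F
  obtain ⟨g0, g1, g2, g3⟩ := g
  rcases spoBasis_index_cases i with rfl | rfl | rfl | rfl | rfl | rfl | rfl | rfl
  all_goals
    simp only [
      lieDensity_spoBasis_0, lieDensity_spoBasis_1, lieDensity_spoBasis_2,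
      lieDensity_spoBasis_3, lieDensity_spoBasis_4, lieDensity_spoBasis_5,
      lieDensity_spoBasis_6, lieDensity_spoBasis_7, evenPart_spoBasis_0,
      evenPart_spoBasis_1, evenPart_spoBasis_2, evenPart_spoBasis_3, evenPart_spoBasis_4,
      evenPart_spoBasis_5, evenPart_spoBasis_6, evenPart_spoBasis_7, oddPart_spoBasis_0,
      oddPart_spoBasis_1, oddPart_spoBasis_2, oddPart_spoBasis_3, oddPart_spoBasis_4,
      oddPart_spoBasis_5, oddPart_spoBasis_6, oddPart_spoBasis_7, lieDensity_zero,
      LinearMap.zero_apply]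
    try simp only [
      spoBasis_0, spoBasis_1, spoBasis_2, spoBasis_3, spoBasis_4, spoBasis_5, spoBasis_6,
      spoBasis_7]
    ext1
  all_goals
    simp only [
      SF.mul_c0, SF.mul_c1, SF.mul_c2, SF.mul_c12, SF.add_c0, SF.add_c1, SF.add_c2,
      SF.add_c12, SF.sub_c0, SF.sub_c1, SF.sub_c2, SF.sub_c12, SF.smul_c0, SF.smul_c1,
      SF.smul_c2, SF.smul_c12, SF.neg_c0, SF.neg_c1, SF.neg_c2, SF.neg_c12, dx_c0, dx_c1,
      dx_c2, dx_c12, dx_pow_c0, dx_pow_c1, dx_pow_c2, dx_pow_c12, Dbar1_c0, Dbar1_c1,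
      Dbar1_c2, Dbar1_c12, Dbar2_c0, Dbar2_c1, Dbar2_c2, Dbar2_c12, par_c0, par_c1, par_c2,
      par_c12, theta1_c0, theta1_c1, theta1_c2, theta1_c12, theta2_c0, theta2_c1, theta2_c2,
      theta2_c12, SF.zero_c0, SF.zero_c1, SF.zero_c2, SF.zero_c12, LinearMap.neg_apply,
      LinearMap.smul_apply, mulL_apply, derivSmooth_mul, derivSmooth_coordX,
      derivSmooth_one, derivSmooth_pow_succ, derivSmooth_pow_comm, Smooth.map_add,
      Smooth.map_neg, Smooth.map_sub, Smooth.map_smul, Smooth.map_zero, Smooth.mul_add,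
      Smooth.mul_neg, Smooth.mul_sub, Smooth.mul_smul, Smooth.mul_zero, Smooth.zero_mul,
      Smooth.mul_one, Smooth.one_mul, Smooth.smul_zero, Smooth.add_zero, Smooth.zero_add,
      Smooth.sub_zero, Smooth.neg_zero, Smooth.pow_zero_apply, Smooth.pow_one_apply,
      derivSmooth_pow_coordX_sq_mul, Nat.add_sub_cancel, zero_add, Nat.cast_zero]
    try simp only [
      derivSmooth_pow_comm, derivSmooth_pow_coordX_mul, derivSmooth_mul, derivSmooth_coordX,
      derivSmooth_one, Smooth.map_add, Smooth.map_neg, Smooth.map_sub, Smooth.map_smul,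
      Smooth.map_zero, Smooth.one_mul]
  all_goals
    apply Smooth.ext'
    intro x
    simp only [
      Smooth.coe_mul_apply, Smooth.coe_add_apply, Smooth.coe_smul_apply,
      Smooth.coe_one_apply, Smooth.coe_sub_apply, Smooth.coe_neg_apply,
      Smooth.coe_zero_apply]
    try push_cast
    try ring1

set_option maxHeartbeats 20000000 in
-- Moving `∂ₓᵏ` past the vector field by the Leibniz rule produces, besides the symbol action, the
-- derivatives `D̄ᵢ(f')` and `f''`. Nothing further appears because the Hamiltonians have degree at
-- most two in `x`.
theorem lieOp_qAffPair_even_succ (lam mu : ℂ) (i : Fin 8) (k : ℕ) (F : SF × SF) :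
    lieOp lam mu (spoBasis i) (qAffPair (2 * (k + 1)) F) =
      qAffPair (2 * (k + 1)) (lieSymbolPair (mu - lam) (2 * (k + 1)) (spoBasis i) F) +
      qAffPair (2 * k + 1) (corrOne lam (2 * (k + 1)) (spoBasis i) F) +
      qAffPair (2 * k) (corrTwo lam (2 * (k + 1))
        (-(1 / 2 : ℂ) • mulL (dx (dx (spoBasis i)))) F) := by
  have e : (2 * (k + 1)) / 2 = k + 1 := by omega
  have e' : Even (2 * (k + 1)) := even_two_mul _
  -- The lower term `qAffPair (2 * k)` contains `∂ₓ^(k-1)`, which is truncated at `k = 0`. There the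
  -- coefficient `A_0 = 0` removes it.
  rcases k with _ | k
  all_goals
    apply LinearMap.ext
    intro g
    simp only [LinearMap.add_apply, lieOp_apply, qAffPair_even, qAffPair_odd, corrOne, corr, corrTwo,
      lieSymbolPair, e, e', if_true, if_false, Nat.add_sub_cancel, coeffA, coeffB]
    obtain ⟨⟨a0, a1, a2, a3⟩, ⟨b0, b1, b2, b3⟩⟩ := F
    obtain ⟨g0, g1, g2, g3⟩ := g
    rcases spoBasis_index_cases i with rfl | rfl | rfl | rfl | rfl | rfl | rfl | rfl
    all_goals
      simp only [
        lieDensity_spoBasis_0, lieDensity_spoBasis_1, lieDensity_spoBasis_2,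
        lieDensity_spoBasis_3, lieDensity_spoBasis_4, lieDensity_spoBasis_5,
        lieDensity_spoBasis_6, lieDensity_spoBasis_7, evenPart_spoBasis_0,
        evenPart_spoBasis_1, evenPart_spoBasis_2, evenPart_spoBasis_3, evenPart_spoBasis_4,
        evenPart_spoBasis_5, evenPart_spoBasis_6, evenPart_spoBasis_7, oddPart_spoBasis_0,
        oddPart_spoBasis_1, oddPart_spoBasis_2, oddPart_spoBasis_3, oddPart_spoBasis_4,
        oddPart_spoBasis_5, oddPart_spoBasis_6, oddPart_spoBasis_7, lieDensity_zero,
        LinearMap.zero_apply]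
      try simp only [
        spoBasis_0, spoBasis_1, spoBasis_2, spoBasis_3, spoBasis_4, spoBasis_5, spoBasis_6,
        spoBasis_7]
      ext1
    all_goals
      simp only [
        SF.mul_c0, SF.mul_c1, SF.mul_c2, SF.mul_c12, SF.add_c0, SF.add_c1, SF.add_c2,
        SF.add_c12, SF.sub_c0, SF.sub_c1, SF.sub_c2, SF.sub_c12, SF.smul_c0, SF.smul_c1,
        SF.smul_c2, SF.smul_c12, SF.neg_c0, SF.neg_c1, SF.neg_c2, SF.neg_c12, dx_c0, dx_c1,
        dx_c2, dx_c12, dx_pow_c0, dx_pow_c1, dx_pow_c2, dx_pow_c12, Dbar1_c0, Dbar1_c1,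
        Dbar1_c2, Dbar1_c12, Dbar2_c0, Dbar2_c1, Dbar2_c2, Dbar2_c12, par_c0, par_c1, par_c2,
        par_c12, theta1_c0, theta1_c1, theta1_c2, theta1_c12, theta2_c0, theta2_c1, theta2_c2,
        theta2_c12, SF.zero_c0, SF.zero_c1, SF.zero_c2, SF.zero_c12, LinearMap.neg_apply,
        LinearMap.smul_apply, mulL_apply, derivSmooth_mul, derivSmooth_coordX,
        derivSmooth_one, derivSmooth_pow_succ, derivSmooth_pow_comm, Smooth.map_add,
        Smooth.map_neg, Smooth.map_sub, Smooth.map_smul, Smooth.map_zero, Smooth.mul_add,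
        Smooth.mul_neg, Smooth.mul_sub, Smooth.mul_smul, Smooth.mul_zero, Smooth.zero_mul,
        Smooth.mul_one, Smooth.one_mul, Smooth.smul_zero, Smooth.add_zero, Smooth.zero_add,
        Smooth.sub_zero, Smooth.neg_zero, Smooth.pow_zero_apply, Smooth.pow_one_apply,
        derivSmooth_pow_coordX_sq_mul, Nat.add_sub_cancel, zero_add, Nat.cast_zero]
      try simp only [
        derivSmooth_pow_comm, derivSmooth_pow_coordX_mul, derivSmooth_mul, derivSmooth_coordX,
        derivSmooth_one, Smooth.map_add, Smooth.map_neg, Smooth.map_sub, Smooth.map_smul,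
        Smooth.map_zero, Smooth.one_mul]
    all_goals
      apply Smooth.ext'
      intro x
      simp only [
        Smooth.coe_mul_apply, Smooth.coe_add_apply, Smooth.coe_smul_apply,
        Smooth.coe_one_apply, Smooth.coe_sub_apply, Smooth.coe_neg_apply,
        Smooth.coe_zero_apply]
      try push_cast
      try ring1

set_option maxHeartbeats 20000000 in
theorem lieOp_qAffPair_odd_succ (lam mu : ℂ) (i : Fin 8) (k : ℕ) (F : SF × SF) :
    lieOp lam mu (spoBasis i) (qAffPair (2 * (k + 1) + 1) F) =
      qAffPair (2 * (k + 1) + 1) (lieSymbolPair (mu - lam) (2 * (k + 1) + 1) (spoBasis i) F) +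
      qAffPair (2 * (k + 1)) (corrOne lam (2 * (k + 1) + 1) (spoBasis i) F) +
      qAffPair (2 * k + 1) (corrTwo lam (2 * (k + 1) + 1)
        (-(1 / 2 : ℂ) • mulL (dx (dx (spoBasis i)))) F) := by
  have e : (2 * (k + 1) + 1) / 2 = k + 1 := by omega
  have e' : ¬ Even (2 * (k + 1) + 1) := by simp
  apply LinearMap.ext
  intro g
  simp only [LinearMap.add_apply, lieOp_apply, qAffPair_even, qAffPair_odd, corrOne, corr, corrTwo,
    lieSymbolPair, e, e', if_true, if_false, Nat.add_sub_cancel, coeffA, coeffB]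
  obtain ⟨⟨a0, a1, a2, a3⟩, ⟨b0, b1, b2, b3⟩⟩ := F
  obtain ⟨g0, g1, g2, g3⟩ := g
  rcases spoBasis_index_cases i with rfl | rfl | rfl | rfl | rfl | rfl | rfl | rfl
  all_goals
    simp only [
      lieDensity_spoBasis_0, lieDensity_spoBasis_1, lieDensity_spoBasis_2,
      lieDensity_spoBasis_3, lieDensity_spoBasis_4, lieDensity_spoBasis_5,
      lieDensity_spoBasis_6, lieDensity_spoBasis_7, evenPart_spoBasis_0,
      evenPart_spoBasis_1, evenPart_spoBasis_2, evenPart_spoBasis_3, evenPart_spoBasis_4,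
      evenPart_spoBasis_5, evenPart_spoBasis_6, evenPart_spoBasis_7, oddPart_spoBasis_0,
      oddPart_spoBasis_1, oddPart_spoBasis_2, oddPart_spoBasis_3, oddPart_spoBasis_4,
      oddPart_spoBasis_5, oddPart_spoBasis_6, oddPart_spoBasis_7, lieDensity_zero,
      LinearMap.zero_apply]
    try simp only [
      spoBasis_0, spoBasis_1, spoBasis_2, spoBasis_3, spoBasis_4, spoBasis_5, spoBasis_6,
      spoBasis_7]
    ext1
  all_goals
    simp only [
      SF.mul_c0, SF.mul_c1, SF.mul_c2, SF.mul_c12, SF.add_c0, SF.add_c1, SF.add_c2,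
      SF.add_c12, SF.sub_c0, SF.sub_c1, SF.sub_c2, SF.sub_c12, SF.smul_c0, SF.smul_c1,
      SF.smul_c2, SF.smul_c12, SF.neg_c0, SF.neg_c1, SF.neg_c2, SF.neg_c12, dx_c0, dx_c1,
      dx_c2, dx_c12, dx_pow_c0, dx_pow_c1, dx_pow_c2, dx_pow_c12, Dbar1_c0, Dbar1_c1,
      Dbar1_c2, Dbar1_c12, Dbar2_c0, Dbar2_c1, Dbar2_c2, Dbar2_c12, par_c0, par_c1, par_c2,
      par_c12, theta1_c0, theta1_c1, theta1_c2, theta1_c12, theta2_c0, theta2_c1, theta2_c2,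
      theta2_c12, SF.zero_c0, SF.zero_c1, SF.zero_c2, SF.zero_c12, LinearMap.neg_apply,
      LinearMap.smul_apply, mulL_apply, derivSmooth_mul, derivSmooth_coordX,
      derivSmooth_one, derivSmooth_pow_succ, derivSmooth_pow_comm, Smooth.map_add,
      Smooth.map_neg, Smooth.map_sub, Smooth.map_smul, Smooth.map_zero, Smooth.mul_add,
      Smooth.mul_neg, Smooth.mul_sub, Smooth.mul_smul, Smooth.mul_zero, Smooth.zero_mul,
      Smooth.mul_one, Smooth.one_mul, Smooth.smul_zero, Smooth.add_zero, Smooth.zero_add,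
      Smooth.sub_zero, Smooth.neg_zero, Smooth.pow_zero_apply, Smooth.pow_one_apply,
      derivSmooth_pow_coordX_sq_mul, Nat.add_sub_cancel, zero_add, Nat.cast_zero]
    try simp only [
      derivSmooth_pow_comm, derivSmooth_pow_coordX_mul, derivSmooth_mul, derivSmooth_coordX,
      derivSmooth_one, Smooth.map_add, Smooth.map_neg, Smooth.map_sub, Smooth.map_smul,
      Smooth.map_zero, Smooth.one_mul]
  all_goals
    apply Smooth.ext'
    intro x
    simp only [
      Smooth.coe_mul_apply, Smooth.coe_add_apply, Smooth.coe_smul_apply,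
      Smooth.coe_one_apply, Smooth.coe_sub_apply, Smooth.coe_neg_apply,
      Smooth.coe_zero_apply]
    try push_cast
    try ring1

/-! ### Bilinearity of the action -/

theorem lieDensity_add_left (w : ℂ) (f f' : SF) :
    lieDensity w (f + f') = lieDensity w f + lieDensity w f' := by
  simp only [lieDensity, contactField, map_add, add_mul, smul_add]
  abel

theorem lieDensity_smul_left (w c : ℂ) (f : SF) :
    lieDensity w (c • f) = c • lieDensity w f := by
  simp only [lieDensity, contactField, map_smul, smul_mul_assoc, smul_add, smul_sub,
    smul_comm _ c]

/-- The action on operators, as a bilinear map. -/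
def lieOpBilin (lam mu : ℂ) : SF →ₗ[ℂ] Op →ₗ[ℂ] Op :=
  LinearMap.mk₂ ℂ (lieOp lam mu)
    (fun f f' T => by simp only [lieOp, map_add, lieDensity_add_left, add_mul, mul_add]; abel)
    (fun c f T => by
      simp only [lieOp, map_smul, lieDensity_smul_left, smul_mul_assoc, mul_smul_comm, smul_add,
        smul_sub])
    (fun f T T' => by simp only [lieOp, add_mul, mul_add]; abel)
    (fun c f T => by
      simp only [lieOp, smul_mul_assoc, mul_smul_comm, smul_add, smul_sub])

theorem lieOpBilin_apply (lam mu : ℂ) (f : SF) (T : Op) :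
    lieOpBilin lam mu f T = lieOp lam mu f T := rfl

theorem lieOp_add (lam mu : ℂ) (f : SF) (T T' : Op) :
    lieOp lam mu f (T + T') = lieOp lam mu f T + lieOp lam mu f T' :=
  map_add (lieOpBilin lam mu f) T T'

theorem casimir_eq (lam mu : ℂ) (T : Op) : casimir lam mu T =
    -(1 / 2 : ℂ) • lieOp lam mu (spoBasis 7) (lieOp lam mu (spoBasis 0) T)
    - lieOp lam mu (spoBasis 5) (lieOp lam mu (spoBasis 1) T)
    - lieOp lam mu (spoBasis 6) (lieOp lam mu (spoBasis 2) T)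
    + lieOp lam mu (spoBasis 3) (lieOp lam mu (spoBasis 3) T)
    + lieOp lam mu (spoBasis 4) (lieOp lam mu (spoBasis 4) T)
    + lieOp lam mu (spoBasis 1) (lieOp lam mu (spoBasis 5) T)
    + lieOp lam mu (spoBasis 2) (lieOp lam mu (spoBasis 6) T)
    - (1 / 2 : ℂ) • lieOp lam mu (spoBasis 0) (lieOp lam mu (spoBasis 7) T) := by
  have h (i : Fin 8) (T : Op) : lieOp lam mu (spoDualBasis i) T =
      (dualCoeff i : ℂ) • lieOp lam mu (spoBasis (dualIndex i)) T := by
    simp only [← lieOpBilin_apply, spoDualBasis, map_smul, LinearMap.smul_apply]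
  simp only [casimir, Fin.sum_univ_eight, h]
  simp [dualCoeff, dualIndex]
  module

/-- The Casimir operator, as a linear map. -/
def casimirLin (lam mu : ℂ) : Op →ₗ[ℂ] Op :=
  ∑ i : Fin 8, lieOpBilin lam mu (spoDualBasis i) ∘ₗ lieOpBilin lam mu (spoBasis i)

theorem casimirLin_apply (lam mu : ℂ) (T : Op) : casimirLin lam mu T = casimir lam mu T := by
  simp [casimirLin, casimir, lieOpBilin_apply]

/-! ### The Casimir operator on symbols -/

/-- `A_0 = 0` is what makes truncated subtraction of degrees harmless. Here and in the next four
lemmas it removes the corrections that would fall below degree `0`, and the second component of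
those landing in degree `0`. -/
theorem corr_zero (lam : ℂ) (u v : Op) (F : SF × SF) (hF : F.2 = 0) : corr lam 0 u v F = 0 := by
  ext1 <;> simp [corr, coeffA, hF]

theorem corrTwo_zero (lam : ℂ) (u : Op) (F : SF × SF) : corrTwo lam 0 u F = 0 := by
  ext1 <;> simp [corrTwo, coeffA]

theorem corrTwo_one (lam : ℂ) (u : Op) (F : SF × SF) : corrTwo lam 1 u F = 0 := by
  ext1 <;> simp [corrTwo, coeffA]

theorem corr_snd (lam : ℂ) (n : ℕ) (u v : Op) (F : SF × SF) (hF : n = 0 → F.2 = 0)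
    (hn : n - 1 = 0) : (corr lam n u v F).2 = 0 := by
  obtain rfl | rfl : n = 0 ∨ n = 1 := by omega
  · rw [corr_zero _ _ _ _ (hF rfl)]; rfl
  · simp [corr, coeffA]

theorem corrTwo_snd (lam : ℂ) (n : ℕ) (u : Op) (F : SF × SF) (hn : n - 2 = 0) :
    (corrTwo lam n u F).2 = 0 := by
  obtain rfl | rfl | rfl : n = 0 ∨ n = 1 ∨ n = 2 := by omega
  · rw [corrTwo_zero]; rfl
  · rw [corrTwo_one]; rfl
  · simp [corrTwo, coeffA]

theorem lieSymbolPair_snd (del : ℂ) (n : ℕ) (f : SF) (F : SF × SF) (hF : n = 0 → F.2 = 0)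
    (hn : n = 0) : (lieSymbolPair del n f F).2 = 0 :=
  (lieSymbol del n f ⟨F, hF⟩).2 hn

theorem lieOp_qAffPair (lam mu : ℂ) (i : Fin 8) (n : ℕ) (F : SF × SF) (hF : n = 0 → F.2 = 0) :
    lieOp lam mu (spoBasis i) (qAffPair n F) =
      qAffPair n (lieSymbolPair (mu - lam) n (spoBasis i) F) +
      qAffPair (n - 1) (corrOne lam n (spoBasis i) F) +
      qAffPair (n - 2) (corrTwo lam n
        (-(1 / 2 : ℂ) • mulL (dx (dx (spoBasis i)))) F) := by
  obtain ⟨k, rfl | rfl⟩ := n.even_or_odd' <;> rcases k with _ | k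
  · have h := lieOp_qAffPair_zero lam mu i F (hF rfl)
    simp only [mul_zero] at h ⊢
    simp [h, corrOne, corr_zero _ _ _ _ (hF rfl), corrTwo_zero]
  · exact lieOp_qAffPair_even_succ lam mu i k F
  · have h := lieOp_qAffPair_one lam mu i F
    simp only [mul_zero, zero_add] at h ⊢
    simp [h, corrTwo_one]
  · exact lieOp_qAffPair_odd_succ lam mu i k F

/-- For `1, θ₁, θ₂, x, θ₁θ₂` the derivative `f'` is constant, hence killed by `D̄₁` and `D̄₂`. -/
theorem corrOne_of_affine (lam : ℂ) (n : ℕ) {i : Fin 8} (hi : i < 5) (F : SF × SF) :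
    corrOne lam n (spoBasis i) F = 0 := by
  have h : Dbar1 (dx (par (spoBasis i))) = 0 ∧ Dbar2 (dx (par (spoBasis i))) = 0 := by
    rcases spoBasis_index_cases i with rfl | rfl | rfl | rfl | rfl | rfl | rfl | rfl
    · constructor <;> ext1 <;> simp [spoBasis_0]
    · constructor <;> ext1 <;> simp [spoBasis_1]
    · constructor <;> ext1 <;> simp [spoBasis_2]
    · constructor <;> ext1 <;> simp [spoBasis_3]
    · constructor <;> ext1 <;> simp [spoBasis_4]
    all_goals exact absurd hi (by decide)
  unfold corrOne corr
  rw [h.1, h.2]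
  split_ifs <;> ext1 <;> simp

theorem dx_dx_spoBasis {i : Fin 8} (hi : i < 7) : dx (dx (spoBasis i)) = 0 := by
  rcases spoBasis_index_cases i with rfl | rfl | rfl | rfl | rfl | rfl | rfl | rfl
  · ext1 <;> simp [spoBasis_0]
  · ext1 <;> simp [spoBasis_1]
  · ext1 <;> simp [spoBasis_2]
  · ext1 <;> simp [spoBasis_3]
  · ext1 <;> simp [spoBasis_4]
  · ext1 <;> simp [spoBasis_5]
  · ext1 <;> simp [spoBasis_6]
  · exact absurd hi (by decide)

theorem corrTwo_map_zero (lam : ℂ) (n : ℕ) (F : SF × SF) : corrTwo lam n 0 F = 0 := by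
  unfold corrTwo
  split_ifs <;> ext1 <;> simp

theorem lieOp_qAffPair_of_affine (lam mu : ℂ) {i : Fin 8} (hi : i < 5) (n : ℕ) (F : SF × SF)
    (hF : n = 0 → F.2 = 0) : lieOp lam mu (spoBasis i) (qAffPair n F) =
      qAffPair n (lieSymbolPair (mu - lam) n (spoBasis i) F) := by
  rw [lieOp_qAffPair _ _ _ _ _ hF, corrOne_of_affine _ _ hi,
    dx_dx_spoBasis (hi.trans (by decide))]
  simp [corrTwo_map_zero]

theorem lieOp_qAffPair_of_lt (lam mu : ℂ) {i : Fin 8} (hi : i < 7) (n : ℕ) (F : SF × SF)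
    (hF : n = 0 → F.2 = 0) : lieOp lam mu (spoBasis i) (qAffPair n F) =
      qAffPair n (lieSymbolPair (mu - lam) n (spoBasis i) F) +
      qAffPair (n - 1) (corrOne lam n (spoBasis i) F) := by
  rw [lieOp_qAffPair _ _ _ _ _ hF, dx_dx_spoBasis hi]
  simp [corrTwo_map_zero]

set_option maxHeartbeats 4000000 in
-- On densities of weight `w = δ - n / 2` the Casimir operator is `w²`. In half-integer degrees the
-- pair is also rotated by `½ D̄₁D̄₂(f)`, which lowers the value by `1 / 4`.
theorem casimir_symbol (del : ℂ) (n : ℕ) (F : SF × SF) :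
    -(1 / 2 : ℂ) • lieSymbolPair del n (spoBasis 7) (lieSymbolPair del n (spoBasis 0) F)
    - lieSymbolPair del n (spoBasis 5) (lieSymbolPair del n (spoBasis 1) F)
    - lieSymbolPair del n (spoBasis 6) (lieSymbolPair del n (spoBasis 2) F)
    + lieSymbolPair del n (spoBasis 3) (lieSymbolPair del n (spoBasis 3) F)
    + lieSymbolPair del n (spoBasis 4) (lieSymbolPair del n (spoBasis 4) F)
    + lieSymbolPair del n (spoBasis 1) (lieSymbolPair del n (spoBasis 5) F)
    + lieSymbolPair del n (spoBasis 2) (lieSymbolPair del n (spoBasis 6) F)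
    - (1 / 2 : ℂ) • lieSymbolPair del n (spoBasis 0) (lieSymbolPair del n (spoBasis 7) F) =
      alpha del n • F := by
  have e4 : Dbar1 (Dbar2 (spoBasis 4)) = ⟨-1, 0, 0, 0⟩ := by ext1 <;> simp [spoBasis_4]
  have e5 : Dbar1 (Dbar2 (spoBasis 5)) = ⟨0, 0, 1, 0⟩ := by ext1 <;> simp [spoBasis_5]
  have e6 : Dbar1 (Dbar2 (spoBasis 6)) = ⟨0, -1, 0, 0⟩ := by ext1 <;> simp [spoBasis_6]
  have e0 : Dbar1 (Dbar2 (spoBasis 0)) = 0 := by ext1 <;> simp [spoBasis_0]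
  have e1 : Dbar1 (Dbar2 (spoBasis 1)) = 0 := by ext1 <;> simp [spoBasis_1]
  have e2 : Dbar1 (Dbar2 (spoBasis 2)) = 0 := by ext1 <;> simp [spoBasis_2]
  have e3 : Dbar1 (Dbar2 (spoBasis 3)) = 0 := by ext1 <;> simp [spoBasis_3]
  have e7 : Dbar1 (Dbar2 (spoBasis 7)) = (2 : ℂ) • ⟨0, 0, 0, 1⟩ := by
    apply sf_ext <;> intro x <;> simp [spoBasis_7]; norm_num
  obtain ⟨⟨a0, a1, a2, a3⟩, ⟨b0, b1, b2, b3⟩⟩ := F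
  by_cases hn : Even n
  all_goals
    simp only [lieSymbolPair, alpha, hn, if_true, if_false, e0, e1, e2, e3, e4, e5, e6, e7,
      lieDensity_spoBasis_0, lieDensity_spoBasis_1, lieDensity_spoBasis_2, lieDensity_spoBasis_3,
      lieDensity_spoBasis_4, lieDensity_spoBasis_5, lieDensity_spoBasis_6, lieDensity_spoBasis_7]
    ext1 <;> apply sf_ext <;> intro x
  all_goals
    simp only [
      Prod.fst_add, Prod.snd_add, Prod.fst_sub, Prod.snd_sub, Prod.smul_fst, Prod.smul_snd,
      SF.mul_c0, SF.mul_c1, SF.mul_c2, SF.mul_c12, SF.add_c0, SF.add_c1, SF.add_c2,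
      SF.add_c12, SF.sub_c0, SF.sub_c1, SF.sub_c2, SF.sub_c12, SF.smul_c0, SF.smul_c1,
      SF.smul_c2, SF.smul_c12, SF.neg_c0, SF.neg_c1, SF.neg_c2, SF.neg_c12, dx_c0, dx_c1,
      dx_c2, dx_c12, Dbar1_c0, Dbar1_c1, Dbar1_c2, Dbar1_c12, Dbar2_c0, Dbar2_c1, Dbar2_c2,
      Dbar2_c12, par_c0, par_c1, par_c2, par_c12, theta1_c0, theta1_c1, theta1_c2,
      theta1_c12, theta2_c0, theta2_c1, theta2_c2, theta2_c12, SF.zero_c0, SF.zero_c1,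
      SF.zero_c2, SF.zero_c12, derivSmooth_mul, derivSmooth_coordX, derivSmooth_one,
      Smooth.map_add, Smooth.map_neg, Smooth.map_sub, Smooth.map_smul, Smooth.map_zero,
      Smooth.mul_zero, Smooth.zero_mul, Smooth.mul_one, Smooth.one_mul, Smooth.smul_zero,
      Smooth.add_zero, Smooth.zero_add, Smooth.sub_zero, Smooth.neg_zero]
    simp only [
      Smooth.coe_mul_apply, Smooth.coe_add_apply, Smooth.coe_smul_apply,
      Smooth.coe_one_apply, Smooth.coe_sub_apply, Smooth.coe_neg_apply,
      Smooth.coe_zero_apply]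
    ring

set_option maxHeartbeats 4000000 in
-- The generators `X_{xθᵢ}` contribute the correction with constant entries, composed with `X_{θᵢ} =
-- ½ (∂_{θᵢ} + θᵢ ∂ₓ)`. The two orders add up because `par` anticommutes with `X_{θᵢ}`, giving
-- `∂_{θᵢ} + θᵢ ∂ₓ`. The pair `1, x²` contributes `-2 θᵢ ∂ₓ`, and the sum is `D̄ᵢ`.
theorem casimir_corrOne (lam del : ℂ) (n : ℕ) (F : SF × SF) :
    -(1 / 2 : ℂ) • corrOne lam n (spoBasis 7) (lieSymbolPair del n (spoBasis 0) F)
    - corrOne lam n (spoBasis 5) (lieSymbolPair del n (spoBasis 1) F)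
    - corrOne lam n (spoBasis 6) (lieSymbolPair del n (spoBasis 2) F)
    + lieSymbolPair del (n - 1) (spoBasis 1) (corrOne lam n (spoBasis 5) F)
    + lieSymbolPair del (n - 1) (spoBasis 2) (corrOne lam n (spoBasis 6) F)
    - (1 / 2 : ℂ) • lieSymbolPair del (n - 1) (spoBasis 0) (corrOne lam n (spoBasis 7) F) =
      corr lam n Dbar1 Dbar2 F := by
  -- For `f = 1, θ₁, θ₂` both `f'` and `D̄₁D̄₂(f)` vanish, so neither the weight nor the rotation of
  -- pairs enters, and the action is the same in degrees `n` and `n - 1`.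
  have l (i : Fin 8) (hi : i < 3) (m : ℕ) (G : SF × SF) : lieSymbolPair del m (spoBasis i) G =
      (lieDensity 0 (spoBasis i) G.1, lieDensity 0 (spoBasis i) G.2) := by
    have e0 : Dbar1 (Dbar2 (spoBasis 0)) = 0 := by ext1 <;> simp [spoBasis_0]
    have e1 : Dbar1 (Dbar2 (spoBasis 1)) = 0 := by ext1 <;> simp [spoBasis_1]
    have e2 : Dbar1 (Dbar2 (spoBasis 2)) = 0 := by ext1 <;> simp [spoBasis_2]
    rcases spoBasis_index_cases i with rfl | rfl | rfl | rfl | rfl | rfl | rfl | rfl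
    · simp only [lieSymbolPair, e0, lieDensity_spoBasis_0]
      split_ifs <;> ext1 <;> ext1 <;> simp
    · simp only [lieSymbolPair, e1, lieDensity_spoBasis_1]
      split_ifs <;> ext1 <;> ext1 <;> simp
    · simp only [lieSymbolPair, e2, lieDensity_spoBasis_2]
      split_ifs <;> ext1 <;> ext1 <;> simp
    all_goals exact absurd hi (by decide)
  rw [l 0 (by decide), l 1 (by decide), l 2 (by decide), l 0 (by decide), l 1 (by decide),
    l 2 (by decide)]
  have e5 : dx (par (spoBasis 5)) = -theta1 := by ext1 <;> simp [spoBasis_5]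
  have e6 : dx (par (spoBasis 6)) = -theta2 := by ext1 <;> simp [spoBasis_6]
  have e7 : dx (par (spoBasis 7)) = (2 : ℂ) • ⟨coordX, 0, 0, 0⟩ := by
    apply sf_ext <;> intro x <;> simp [spoBasis_7]; ring
  obtain ⟨⟨a0, a1, a2, a3⟩, ⟨b0, b1, b2, b3⟩⟩ := F
  by_cases hn : Even n
  all_goals
    simp only [corrOne, corr, hn, if_true, if_false, e5, e6, e7,
      lieDensity_spoBasis_0, lieDensity_spoBasis_1, lieDensity_spoBasis_2]
    ext1 <;> apply sf_ext <;> intro x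
  all_goals
    simp only [
      Prod.fst_add, Prod.snd_add, Prod.fst_sub, Prod.snd_sub, Prod.smul_fst, Prod.smul_snd,
      SF.mul_c0, SF.mul_c1, SF.mul_c2, SF.mul_c12, SF.add_c0, SF.add_c1, SF.add_c2,
      SF.add_c12, SF.sub_c0, SF.sub_c1, SF.sub_c2, SF.sub_c12, SF.smul_c0, SF.smul_c1,
      SF.smul_c2, SF.smul_c12, SF.neg_c0, SF.neg_c1, SF.neg_c2, SF.neg_c12, dx_c0, dx_c1,
      dx_c2, dx_c12, Dbar1_c0, Dbar1_c1, Dbar1_c2, Dbar1_c12, Dbar2_c0, Dbar2_c1, Dbar2_c2,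
      Dbar2_c12, par_c0, par_c1, par_c2, par_c12, theta1_c0, theta1_c1, theta1_c2,
      theta1_c12, theta2_c0, theta2_c1, theta2_c2, theta2_c12, SF.zero_c0, SF.zero_c1,
      SF.zero_c2, SF.zero_c12, LinearMap.neg_apply, mulL_apply, derivSmooth_mul,
      derivSmooth_coordX, derivSmooth_one, Smooth.map_add, Smooth.map_neg, Smooth.map_sub,
      Smooth.map_smul, Smooth.map_zero, Smooth.mul_zero, Smooth.zero_mul, Smooth.mul_one,
      Smooth.one_mul, Smooth.smul_zero, Smooth.add_zero, Smooth.zero_add, Smooth.sub_zero,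
      Smooth.neg_zero]
    simp only [
      Smooth.coe_mul_apply, Smooth.coe_add_apply, Smooth.coe_smul_apply,
      Smooth.coe_one_apply, Smooth.coe_sub_apply, Smooth.coe_neg_apply,
      Smooth.coe_zero_apply]
    ring

theorem lieSymbolPair_spoBasis_zero (del : ℂ) (n : ℕ) (F : SF × SF) :
    lieSymbolPair del n (spoBasis 0) F = (dx F.1, dx F.2) := by
  have e0 : Dbar1 (Dbar2 (spoBasis 0)) = 0 := by ext1 <;> simp [spoBasis_0]
  simp only [lieSymbolPair, e0, lieDensity_spoBasis_0]
  split_ifs <;> ext1 <;> ext1 <;> simp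

/-- Only `x²` has a nonzero second derivative, and `-½ (x²)'' = -1`. Each of the two orders of the
pair `1, x²` then gives one half of `∂ₓ`. -/
theorem casimir_corrTwo (lam del : ℂ) (n : ℕ) (F : SF × SF) :
    -(1 / 2 : ℂ) • corrTwo lam n (-(1 / 2 : ℂ) • mulL (dx (dx (spoBasis 7))))
        (lieSymbolPair del n (spoBasis 0) F)
    - (1 / 2 : ℂ) • lieSymbolPair del (n - 2) (spoBasis 0)
        (corrTwo lam n (-(1 / 2 : ℂ) • mulL (dx (dx (spoBasis 7)))) F) =
      corrTwo lam n dx F := by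
  have e : dx (dx (spoBasis 7)) = (2 : ℂ) • ⟨1, 0, 0, 0⟩ := by
    apply sf_ext <;> intro x <;> simp [spoBasis_7]; norm_num
  have e' : -(1 / 2 : ℂ) • mulL (dx (dx (spoBasis 7))) = -1 := by
    apply LinearMap.ext
    intro g
    rw [e]
    apply sf_ext <;> intro x <;> simp
  rw [e', lieSymbolPair_spoBasis_zero, lieSymbolPair_spoBasis_zero]
  unfold corrTwo
  split_ifs <;> ext1 <;> simp <;> module

/-- Each non-affine generator is paired with one of `X_1, X_{θ₁}, X_{θ₂}`, for which the affine
quantization is equivariant. Every summand therefore carries at most one correction, and collecting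
terms by degree leaves the three preceding computations. -/
theorem casimir_qAffPair (lam mu : ℂ) (n : ℕ) (F : SF × SF) (hF : n = 0 → F.2 = 0) :
    casimir lam mu (qAffPair n F) = alpha (mu - lam) n • qAffPair n F +
      qAffPair (n - 1) (corr lam n Dbar1 Dbar2 F) + qAffPair (n - 2) (corrTwo lam n dx F) := by
  have hl (i : Fin 8) := lieSymbolPair_snd (mu - lam) n (spoBasis i) F hF
  have hc (i : Fin 8) : n - 1 = 0 → (corrOne lam n (spoBasis i) F).2 = 0 :=
    corr_snd lam n _ _ F hF
  rw [casimir_eq, lieOp_qAffPair_of_affine lam mu (i := 0) (by decide) n F hF,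
    lieOp_qAffPair_of_affine lam mu (i := 1) (by decide) n F hF,
    lieOp_qAffPair_of_affine lam mu (i := 2) (by decide) n F hF,
    lieOp_qAffPair_of_affine lam mu (i := 3) (by decide) n F hF,
    lieOp_qAffPair_of_affine lam mu (i := 4) (by decide) n F hF,
    lieOp_qAffPair_of_lt lam mu (i := 5) (by decide) n F hF,
    lieOp_qAffPair_of_lt lam mu (i := 6) (by decide) n F hF,
    lieOp_qAffPair lam mu 7 n F hF]
  simp only [lieOp_add]
  rw [lieOp_qAffPair lam mu 7 n _ (hl 0),
    lieOp_qAffPair_of_lt lam mu (i := 5) (by decide) n _ (hl 1),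
    lieOp_qAffPair_of_lt lam mu (i := 6) (by decide) n _ (hl 2),
    lieOp_qAffPair_of_affine lam mu (i := 3) (by decide) n _ (hl 3),
    lieOp_qAffPair_of_affine lam mu (i := 4) (by decide) n _ (hl 4),
    lieOp_qAffPair_of_affine lam mu (i := 1) (by decide) n _ (hl 5),
    lieOp_qAffPair_of_affine lam mu (i := 1) (by decide) (n - 1) _ (hc 5),
    lieOp_qAffPair_of_affine lam mu (i := 2) (by decide) n _ (hl 6),
    lieOp_qAffPair_of_affine lam mu (i := 2) (by decide) (n - 1) _ (hc 6),
    lieOp_qAffPair_of_affine lam mu (i := 0) (by decide) n _ (hl 7),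
    lieOp_qAffPair_of_affine lam mu (i := 0) (by decide) (n - 1) _ (hc 7),
    lieOp_qAffPair_of_affine lam mu (i := 0) (by decide) (n - 2) _ (corrTwo_snd lam n _ F),
    ← map_smul (qAffPair n), ← casimir_symbol, ← casimir_corrOne lam (mu - lam),
    ← casimir_corrTwo lam (mu - lam)]
  simp only [map_add, map_sub, map_smul]
  module

/-! ### The contact bracket and the invariance of the Casimir operator -/

/-- The contact bracket of Hamiltonians. -/
def contactBracket (f g : SF) : SF :=
  f * dx g - dx f * g - (1 / 2 : ℂ) • (Dbar1 (par f) * Dbar1 g + Dbar2 (par f) * Dbar2 g)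

theorem evenPart_contactBracket_of_odd_even {f g : SF} (hf : evenPart f = 0)
    (hg : oddPart g = 0) : evenPart (contactBracket f g) = 0 := by
  rw [eq_of_evenPart_eq_zero hf, eq_of_oddPart_eq_zero hg]
  ext1 <;> simp [contactBracket]

theorem oddPart_contactBracket_of_odd_odd {f g : SF} (hf : evenPart f = 0)
    (hg : evenPart g = 0) : oddPart (contactBracket f g) = 0 := by
  rw [eq_of_evenPart_eq_zero hf, eq_of_evenPart_eq_zero hg]
  ext1 <;> simp [contactBracket]

/-- `contactBracket f` is the action of `X_f` on densities of weight `-1`. Only brackets with an odd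
first entry are treated, because the odd elements generate `spo(2|2)`. -/
theorem lieDensity_contactBracket_odd_even (w : ℂ) {f g : SF} (hf : evenPart f = 0)
    (hg : oddPart g = 0) : lieDensity w (contactBracket f g) =
      lieDensity w f * lieDensity w g - lieDensity w g * lieDensity w f := by
  apply LinearMap.ext
  intro h
  rw [LinearMap.sub_apply, Module.End.mul_apply, Module.End.mul_apply,
    lieDensity_odd w (evenPart_contactBracket_of_odd_even hf hg)]
  simp only [lieDensity_odd w hf, lieDensity_even w hg]
  rw [eq_of_evenPart_eq_zero hf, eq_of_oddPart_eq_zero hg]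
  apply sf_ext <;> intro x
  all_goals
    simp only [
      SF.mul_c0, SF.mul_c1, SF.mul_c2, SF.mul_c12, SF.add_c0, SF.add_c1, SF.add_c2,
      SF.add_c12, SF.sub_c0, SF.sub_c1, SF.sub_c2, SF.sub_c12, SF.smul_c0, SF.smul_c1,
      SF.smul_c2, SF.smul_c12, dx_c0, dx_c1, dx_c2, dx_c12, Dbar1_c0, Dbar1_c1, Dbar1_c2,
      Dbar1_c12, Dbar2_c0, Dbar2_c1, Dbar2_c2, Dbar2_c12, par_c0, par_c1, par_c2, par_c12,
      SF.zero_c0, SF.zero_c1, SF.zero_c2, SF.zero_c12, contactBracket, derivSmooth_mul,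
      map_add, map_sub, map_neg, map_zero, map_smul]
    simp only [
      Smooth.coe_mul_apply, Smooth.coe_add_apply, Smooth.coe_smul_apply,
      Smooth.coe_one_apply, Smooth.coe_sub_apply, Smooth.coe_neg_apply,
      Smooth.coe_zero_apply]
    ring

theorem lieDensity_contactBracket_odd_odd (w : ℂ) {f g : SF} (hf : evenPart f = 0)
    (hg : evenPart g = 0) : lieDensity w (contactBracket f g) =
      lieDensity w f * lieDensity w g + lieDensity w g * lieDensity w f := by
  apply LinearMap.ext
  intro h
  rw [LinearMap.add_apply, Module.End.mul_apply, Module.End.mul_apply,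
    lieDensity_even w (oddPart_contactBracket_of_odd_odd hf hg)]
  simp only [lieDensity_odd w hf, lieDensity_odd w hg]
  rw [eq_of_evenPart_eq_zero hf, eq_of_evenPart_eq_zero hg]
  apply sf_ext <;> intro x
  all_goals
    simp only [
      SF.mul_c0, SF.mul_c1, SF.mul_c2, SF.mul_c12, SF.add_c0, SF.add_c1, SF.add_c2,
      SF.add_c12, SF.sub_c0, SF.sub_c1, SF.sub_c2, SF.sub_c12, SF.smul_c0, SF.smul_c1,
      SF.smul_c2, SF.smul_c12, dx_c0, dx_c1, dx_c2, dx_c12, Dbar1_c0, Dbar1_c1, Dbar1_c2,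
      Dbar1_c12, Dbar2_c0, Dbar2_c1, Dbar2_c2, Dbar2_c12, par_c0, par_c1, par_c2, par_c12,
      SF.zero_c0, SF.zero_c1, SF.zero_c2, SF.zero_c12, contactBracket, derivSmooth_mul,
      map_add, map_sub, map_neg, map_zero, map_smul]
    simp only [
      Smooth.coe_mul_apply, Smooth.coe_add_apply, Smooth.coe_smul_apply,
      Smooth.coe_one_apply, Smooth.coe_sub_apply, Smooth.coe_neg_apply,
      Smooth.coe_zero_apply]
    ring

/-! ### Parity and the representation of brackets on operators. -/

theorem par_mul_par : par * par = 1 := by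
  apply LinearMap.ext
  intro g
  ext1 <;> simp

theorem par_mul_lieDensity_even (w : ℂ) {f : SF} (hf : oddPart f = 0) :
    par * lieDensity w f = lieDensity w f * par := by
  apply LinearMap.ext
  intro g
  rw [Module.End.mul_apply, Module.End.mul_apply, lieDensity_even w hf, lieDensity_even w hf]
  apply sf_ext <;> intro x <;> simp <;> ring

theorem par_mul_lieDensity_odd (w : ℂ) {f : SF} (hf : evenPart f = 0) :
    par * lieDensity w f = -(lieDensity w f * par) := by
  apply LinearMap.ext
  intro g
  rw [LinearMap.neg_apply, Module.End.mul_apply, Module.End.mul_apply, lieDensity_odd w hf,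
    lieDensity_odd w hf]
  apply sf_ext <;> intro x <;> simp <;> ring

theorem lieOp_of_oddPart_eq_zero (lam mu : ℂ) {f : SF} (h : oddPart f = 0) (T : Op) :
    lieOp lam mu f T = lieDensity mu f * T - T * lieDensity lam f := by
  have h' : evenPart f = f := (eq_of_oddPart_eq_zero h).symm
  simp [lieOp, h, h', lieDensity_zero]

theorem lieOp_of_evenPart_eq_zero (lam mu : ℂ) {f : SF} (h : evenPart f = 0) (T : Op) :
    lieOp lam mu f T = lieDensity mu f * T - par * T * par * lieDensity lam f := by
  have h' : oddPart f = f := (eq_of_evenPart_eq_zero h).symm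
  simp [lieOp, h, h', lieDensity_zero]

theorem lieOp_contactBracket_odd_even (lam mu : ℂ) {f g : SF} (hf : evenPart f = 0)
    (hg : oddPart g = 0) (T : Op) : lieOp lam mu (contactBracket f g) T =
      lieOp lam mu f (lieOp lam mu g T) - lieOp lam mu g (lieOp lam mu f T) := by
  have h1 (w : ℂ) (R : Op) : par * (lieDensity w g * R) = lieDensity w g * (par * R) := by
    rw [← mul_assoc, par_mul_lieDensity_even w hg, mul_assoc]
  have h2 (w : ℂ) : par * lieDensity w g = lieDensity w g * par := par_mul_lieDensity_even w hg
  simp only [lieOp_of_evenPart_eq_zero lam mu (evenPart_contactBracket_of_odd_even hf hg),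
    lieOp_of_evenPart_eq_zero lam mu hf, lieOp_of_oddPart_eq_zero lam mu hg,
    lieDensity_contactBracket_odd_even _ hf hg, mul_sub, sub_mul, mul_assoc, h1, h2]
  abel

/-- The mixed terms, with one field on each side of `T`, cancel because `par` anticommutes with odd
fields. The terms with both fields on the right lose their two parity twists by `par * par = 1`. -/
theorem lieOp_contactBracket_odd_odd (lam mu : ℂ) {f g : SF} (hf : evenPart f = 0)
    (hg : evenPart g = 0) (T : Op) : lieOp lam mu (contactBracket f g) T =
      lieOp lam mu f (lieOp lam mu g T) + lieOp lam mu g (lieOp lam mu f T) := by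
  have h1 {f : SF} (hf : evenPart f = 0) (w : ℂ) (R : Op) :
      par * (lieDensity w f * R) = -(lieDensity w f * (par * R)) := by
    rw [← mul_assoc, par_mul_lieDensity_odd w hf, neg_mul, mul_assoc]
  have h2 {f : SF} (hf : evenPart f = 0) (w : ℂ) := par_mul_lieDensity_odd w hf
  have h3 (R : Op) : par * (par * R) = R := by rw [← mul_assoc, par_mul_par, one_mul]
  simp only [lieOp_of_oddPart_eq_zero lam mu (oddPart_contactBracket_of_odd_odd hf hg),
    lieOp_of_evenPart_eq_zero lam mu hf, lieOp_of_evenPart_eq_zero lam mu hg,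
    lieDensity_contactBracket_odd_odd _ hf hg, mul_sub, sub_mul, mul_add, add_mul, mul_neg,
    neg_mul, sub_neg_eq_add, neg_add, neg_neg, neg_sub, mul_assoc, h1 hf, h1 hg, h2 hf, h2 hg, h3, par_mul_par,
    mul_one]
  abel

theorem lieOp_lieOp_of_odd_even (lam mu : ℂ) {f g h : SF} {c : ℂ} (hf : evenPart f = 0)
    (hg : oddPart g = 0) (e : contactBracket f g = c • h) (T : Op) :
    lieOp lam mu f (lieOp lam mu g T) =
      lieOp lam mu g (lieOp lam mu f T) + c • lieOp lam mu h T := by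
  have := lieOp_contactBracket_odd_even lam mu hf hg T
  rw [e, ← lieOpBilin_apply, map_smul, LinearMap.smul_apply, lieOpBilin_apply] at this
  rw [this]; abel

theorem lieOp_lieOp_of_odd_odd (lam mu : ℂ) {f g h : SF} {c : ℂ} (hf : evenPart f = 0)
    (hg : evenPart g = 0) (e : contactBracket f g = c • h) (T : Op) :
    lieOp lam mu f (lieOp lam mu g T) =
      -lieOp lam mu g (lieOp lam mu f T) + c • lieOp lam mu h T := by
  have := lieOp_contactBracket_odd_odd lam mu hf hg T
  rw [e, ← lieOpBilin_apply, map_smul, LinearMap.smul_apply, lieOpBilin_apply] at this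
  rw [this]; abel

/-- The brackets of the odd elements `1, 2, 5, 6` of the basis with all elements. -/
def oddBracketCoeff (i j : Fin 8) : ℂ :=
  (![0, ![0, 1 / 2, 0, 1 / 2, 1 / 2, 1 / 2, 1 / 2, 1], ![0, 0, 1 / 2, 1 / 2, -1 / 2, -1 / 2, 1 / 2, 1],
    0, 0, ![-1, 1 / 2, -1 / 2, -1 / 2, 1 / 2, 1 / 2, 0, 0],
    ![-1, 1 / 2, 1 / 2, -1 / 2, -1 / 2, 0, 1 / 2, 0], 0] : Fin 8 → Fin 8 → ℂ) i j
/-- See `oddBracketCoeff`. -/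
def oddBracketIndex (i j : Fin 8) : Fin 8 :=
  (![0, ![0, 0, 0, 1, 2, 3, 4, 5], ![0, 0, 0, 2, 1, 4, 3, 6],
    0, 0, ![1, 3, 4, 5, 6, 7, 0, 0], ![2, 4, 3, 6, 5, 0, 7, 0], 0] : Fin 8 → Fin 8 → Fin 8) i j

/-- The rows of the table belonging to even `i` are placeholders, hence the restriction to the odd
indices. -/
theorem contactBracket_spoBasis {i : Fin 8} (hi : i = 1 ∨ i = 2 ∨ i = 5 ∨ i = 6) (j : Fin 8) :
    contactBracket (spoBasis i) (spoBasis j) =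
      oddBracketCoeff i j • spoBasis (oddBracketIndex i j) := by
  have e1 (g : SF) : contactBracket (spoBasis 1) g =
      (1 / 2 : ℂ) • ⟨g.c1, derivSmooth g.c0, g.c12, derivSmooth g.c2⟩ := by
    apply sf_ext <;> intro x <;> simp [contactBracket, spoBasis_1] <;> ring
  have e2 (g : SF) : contactBracket (spoBasis 2) g =
      (1 / 2 : ℂ) • ⟨g.c2, -g.c12, derivSmooth g.c0, -derivSmooth g.c1⟩ := by
    apply sf_ext <;> intro x <;> simp [contactBracket, spoBasis_2] <;> ring
  have e5 (g : SF) : contactBracket (spoBasis 5) g =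
      (1 / 2 : ℂ) • ⟨coordX * g.c1, coordX * derivSmooth g.c0 - (2 : ℂ) • g.c0, coordX * g.c12,
        coordX * derivSmooth g.c2 - g.c2⟩ := by
    apply sf_ext <;> intro x <;> simp [contactBracket, spoBasis_5] <;> ring
  have e6 (g : SF) : contactBracket (spoBasis 6) g =
      (1 / 2 : ℂ) • ⟨coordX * g.c2, -(coordX * g.c12), coordX * derivSmooth g.c0 - (2 : ℂ) • g.c0,
        -(coordX * derivSmooth g.c1 - g.c1)⟩ := by
    apply sf_ext <;> intro x <;> simp [contactBracket, spoBasis_6] <;> ring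
  rcases hi with rfl | rfl | rfl | rfl
  all_goals
    rcases spoBasis_index_cases j with rfl | rfl | rfl | rfl | rfl | rfl | rfl | rfl
  all_goals
    simp only [oddBracketCoeff, oddBracketIndex, Matrix.cons_val, e1, e2, e5, e6]
    simp only [spoBasis_0, spoBasis_1, spoBasis_2, spoBasis_3, spoBasis_4, spoBasis_5, spoBasis_6,
      spoBasis_7]
    apply sf_ext <;> intro x <;> simp
  all_goals ring

theorem lieOp_spoBasis_odd_even (lam mu : ℂ) {i : Fin 8} (hi : i = 1 ∨ i = 2 ∨ i = 5 ∨ i = 6)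
    {j : Fin 8} (hj : j = 0 ∨ j = 3 ∨ j = 4 ∨ j = 7) (T : Op) :
    lieOp lam mu (spoBasis i) (lieOp lam mu (spoBasis j) T) =
      lieOp lam mu (spoBasis j) (lieOp lam mu (spoBasis i) T) +
        oddBracketCoeff i j • lieOp lam mu (spoBasis (oddBracketIndex i j)) T :=
  lieOp_lieOp_of_odd_even lam mu (by rcases hi with rfl | rfl | rfl | rfl <;> rfl)
    (by rcases hj with rfl | rfl | rfl | rfl <;> rfl) (contactBracket_spoBasis hi j) T

theorem lieOp_spoBasis_odd_odd (lam mu : ℂ) {i : Fin 8} (hi : i = 1 ∨ i = 2 ∨ i = 5 ∨ i = 6)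
    {j : Fin 8} (hj : j = 1 ∨ j = 2 ∨ j = 5 ∨ j = 6) (T : Op) :
    lieOp lam mu (spoBasis i) (lieOp lam mu (spoBasis j) T) =
      -lieOp lam mu (spoBasis j) (lieOp lam mu (spoBasis i) T) +
        oddBracketCoeff i j • lieOp lam mu (spoBasis (oddBracketIndex i j)) T :=
  lieOp_lieOp_of_odd_odd lam mu (by rcases hi with rfl | rfl | rfl | rfl <;> rfl)
    (by rcases hj with rfl | rfl | rfl | rfl <;> rfl) (contactBracket_spoBasis hi j) T

/-! ### The Casimir operator commutes with `spo(2|2)`. -/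

theorem lieOp_spoBasis_odd_even_even (lam mu : ℂ) {i a b : Fin 8}
    (hi : i = 1 ∨ i = 2 ∨ i = 5 ∨ i = 6) (ha : a = 0 ∨ a = 3 ∨ a = 4 ∨ a = 7)
    (hb : b = 0 ∨ b = 3 ∨ b = 4 ∨ b = 7) (T : Op) :
    lieOp lam mu (spoBasis i) (lieOp lam mu (spoBasis a) (lieOp lam mu (spoBasis b) T)) =
      lieOp lam mu (spoBasis a) (lieOp lam mu (spoBasis b) (lieOp lam mu (spoBasis i) T)) +
      oddBracketCoeff i b • lieOp lam mu (spoBasis a)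
        (lieOp lam mu (spoBasis (oddBracketIndex i b)) T) +
      oddBracketCoeff i a • lieOp lam mu (spoBasis (oddBracketIndex i a))
        (lieOp lam mu (spoBasis b) T) := by
  rw [lieOp_spoBasis_odd_even lam mu hi ha, lieOp_spoBasis_odd_even lam mu hi hb, lieOp_add]
  simp only [← lieOpBilin_apply, map_smul]

theorem lieOp_spoBasis_odd_odd_odd (lam mu : ℂ) {i a b : Fin 8}
    (hi : i = 1 ∨ i = 2 ∨ i = 5 ∨ i = 6) (ha : a = 1 ∨ a = 2 ∨ a = 5 ∨ a = 6)
    (hb : b = 1 ∨ b = 2 ∨ b = 5 ∨ b = 6) (T : Op) :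
    lieOp lam mu (spoBasis i) (lieOp lam mu (spoBasis a) (lieOp lam mu (spoBasis b) T)) =
      lieOp lam mu (spoBasis a) (lieOp lam mu (spoBasis b) (lieOp lam mu (spoBasis i) T)) -
      oddBracketCoeff i b • lieOp lam mu (spoBasis a)
        (lieOp lam mu (spoBasis (oddBracketIndex i b)) T) +
      oddBracketCoeff i a • lieOp lam mu (spoBasis (oddBracketIndex i a))
        (lieOp lam mu (spoBasis b) T) := by
  rw [lieOp_spoBasis_odd_odd lam mu hi ha, lieOp_spoBasis_odd_odd lam mu hi hb, lieOp_add]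
  simp only [← lieOpBilin_apply, map_smul, map_neg]
  abel

/-- Moving the odd generator through each quadratic summand leaves bracket terms that are again
products of two generators. By invariance of the form they cancel in the sum over dual bases; with
the bracket table inserted this is a linear identity. -/
theorem casimir_lieOp_odd (lam mu : ℂ) {i : Fin 8} (hi : i = 1 ∨ i = 2 ∨ i = 5 ∨ i = 6)
    (T : Op) : casimir lam mu (lieOp lam mu (spoBasis i) T) =
      lieOp lam mu (spoBasis i) (casimir lam mu T) := by
  have h70 := lieOp_spoBasis_odd_even_even lam mu hi (a := 7) (b := 0) (by decide) (by decide) T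
  have h07 := lieOp_spoBasis_odd_even_even lam mu hi (a := 0) (b := 7) (by decide) (by decide) T
  have h33 := lieOp_spoBasis_odd_even_even lam mu hi (a := 3) (b := 3) (by decide) (by decide) T
  have h44 := lieOp_spoBasis_odd_even_even lam mu hi (a := 4) (b := 4) (by decide) (by decide) T
  have h51 := lieOp_spoBasis_odd_odd_odd lam mu hi (a := 5) (b := 1) (by decide) (by decide) T
  have h62 := lieOp_spoBasis_odd_odd_odd lam mu hi (a := 6) (b := 2) (by decide) (by decide) T
  have h15 := lieOp_spoBasis_odd_odd_odd lam mu hi (a := 1) (b := 5) (by decide) (by decide) T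
  have h26 := lieOp_spoBasis_odd_odd_odd lam mu hi (a := 2) (b := 6) (by decide) (by decide) T
  simp only [casimir_eq, ← lieOpBilin_apply, map_add, map_sub, map_smul] at *
  rw [h70, h07, h33, h44, h51, h62, h15, h26]
  rcases hi with rfl | rfl | rfl | rfl
  all_goals
    simp only [oddBracketCoeff, oddBracketIndex, Matrix.cons_val]
    module

/-- Even generators are multiples of anticommutators of odd ones, so their commutation with the
Casimir operator follows from the odd case. -/
theorem casimir_lieOp_of_bracket (lam mu : ℂ) {i j k : Fin 8}
    (hi : i = 1 ∨ i = 2 ∨ i = 5 ∨ i = 6) (hj : j = 1 ∨ j = 2 ∨ j = 5 ∨ j = 6)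
    (hk : oddBracketIndex i j = k) (hc : oddBracketCoeff i j = 1 / 2) (T : Op) :
    casimir lam mu (lieOp lam mu (spoBasis k) T) =
      lieOp lam mu (spoBasis k) (casimir lam mu T) := by
  have h (T : Op) : lieOp lam mu (spoBasis k) T =
      (2 : ℂ) • (lieOp lam mu (spoBasis i) (lieOp lam mu (spoBasis j) T) +
        lieOp lam mu (spoBasis j) (lieOp lam mu (spoBasis i) T)) := by
    rw [lieOp_spoBasis_odd_odd lam mu hi hj, hk, hc]
    module
  rw [h, h, ← casimirLin_apply, map_smul, map_add]
  simp only [casimirLin_apply, casimir_lieOp_odd lam mu hi, casimir_lieOp_odd lam mu hj]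

theorem casimir_lieOp (lam mu : ℂ) {f : SF} (hf : f ∈ spo) (T : Op) :
    casimir lam mu (lieOp lam mu f T) = lieOp lam mu f (casimir lam mu T) := by
  induction hf using Submodule.span_induction with
  | mem f hf =>
    obtain ⟨i, rfl⟩ := hf
    rcases spoBasis_index_cases i with rfl | rfl | rfl | rfl | rfl | rfl | rfl | rfl
    · exact casimir_lieOp_of_bracket lam mu (i := 1) (j := 1) (by decide) (by decide)
        rfl rfl T
    · exact casimir_lieOp_odd lam mu (by decide) T
    · exact casimir_lieOp_odd lam mu (by decide) T
    · exact casimir_lieOp_of_bracket lam mu (i := 1) (j := 5) (by decide) (by decide)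
        rfl rfl T
    · exact casimir_lieOp_of_bracket lam mu (i := 1) (j := 6) (by decide) (by decide)
        rfl rfl T
    · exact casimir_lieOp_odd lam mu (by decide) T
    · exact casimir_lieOp_odd lam mu (by decide) T
    · exact casimir_lieOp_of_bracket lam mu (i := 5) (j := 5) (by decide) (by decide)
        rfl rfl T
  | zero => simp only [← lieOpBilin_apply, ← casimirLin_apply, map_zero, LinearMap.zero_apply]
  | add f g _ _ ihf ihg =>
    simp only [← lieOpBilin_apply, ← casimirLin_apply, map_add, LinearMap.add_apply] at *
    rw [ihf, ihg]
  | smul c f _ ih =>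
    simp only [← lieOpBilin_apply, ← casimirLin_apply, map_smul, LinearMap.smul_apply] at *
    rw [ih]

/-! ### Injectivity of the affine quantization -/

theorem derivSmooth_coordX_pow_succ (k : ℕ) :
    derivSmooth (coordX ^ (k + 1)) = ((k : ℂ) + 1) • coordX ^ k := by
  induction k with
  | zero => simp
  | succ k ih =>
    rw [pow_succ, derivSmooth_mul, ih, derivSmooth_coordX]
    apply Smooth.ext'
    intro x
    simp only [Smooth.coe_mul_apply, Smooth.coe_add_apply, Smooth.coe_smul_apply, pow_succ,
      Smooth.coe_one_apply]
    push_cast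
    ring

theorem derivSmooth_pow_succ_coordX_pow (k m : ℕ) :
    (derivSmooth ^ (m + 1)) (coordX ^ (k + 1)) =
      ((k : ℂ) + 1) • (derivSmooth ^ m) (coordX ^ k) := by
  rw [derivSmooth_pow_succ, ← derivSmooth_pow_comm, derivSmooth_coordX_pow_succ, map_smul]

theorem derivSmooth_pow_coordX_pow_of_lt {k m : ℕ} (h : k < m) :
    (derivSmooth ^ m) (coordX ^ k) = 0 := by
  induction k generalizing m with
  | zero =>
    obtain ⟨m, rfl⟩ := Nat.exists_eq_succ_of_ne_zero h.ne'
    rw [pow_zero, Nat.succ_eq_add_one, derivSmooth_pow_succ, ← derivSmooth_pow_comm,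
      derivSmooth_one, map_zero]
  | succ k ih =>
    obtain ⟨m, rfl⟩ := Nat.exists_eq_succ_of_ne_zero (by omega : m ≠ 0)
    rw [Nat.succ_eq_add_one, derivSmooth_pow_succ_coordX_pow, ih (by omega), smul_zero]

theorem derivSmooth_pow_coordX_pow_self (k : ℕ) :
    (derivSmooth ^ k) (coordX ^ k) = (k.factorial : ℂ) • 1 := by
  induction k with
  | zero => simp
  | succ k ih =>
    rw [derivSmooth_pow_succ_coordX_pow, ih, smul_smul, Nat.factorial_succ]
    push_cast
    rfl

theorem derivSmooth_pow_coordX_pow_succ {k m : ℕ} (h : k < m + 1) :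
    derivSmooth ((derivSmooth ^ m) (coordX ^ k)) = 0 := by
  rw [← derivSmooth_pow_succ, derivSmooth_pow_coordX_pow_of_lt h]

theorem derivSmooth_pow_coordX_pow_succ_succ {k m : ℕ} (h : k < m + 2) :
    derivSmooth (derivSmooth ((derivSmooth ^ m) (coordX ^ k))) = 0 := by
  rw [← derivSmooth_pow_succ, ← derivSmooth_pow_succ, derivSmooth_pow_coordX_pow_of_lt h]

/-- The summand with `D̄₁D̄₂` does not see `xᵏ`: applied to a function of `x` alone it takes two
further `x`-derivatives, for a total order above `k`. -/
theorem qAffPair_even_testFunction {k j : ℕ} (h : k ≤ j) (F : SF × SF) :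
    qAffPair (2 * j) F ⟨coordX ^ k, 0, 0, 0⟩ =
      (if j = k then (k.factorial : ℂ) else 0) • F.1 := by
  have h2 := derivSmooth_pow_coordX_pow_succ_succ (show k < j - 1 + 2 by omega)
  rw [qAffPair_even]
  split_ifs with e
  · subst e
    ext1 <;> simp [h2, derivSmooth_pow_coordX_pow_self]
  · ext1 <;> simp [h2, derivSmooth_pow_coordX_pow_of_lt (show k < j by omega)]

theorem qAffPair_odd_testFunction {k j : ℕ} (h : k ≤ j) (F : SF × SF) :
    qAffPair (2 * j + 1) F ⟨coordX ^ k, 0, 0, 0⟩ = 0 := by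
  have h1 := derivSmooth_pow_coordX_pow_succ (show k < j + 1 by omega)
  rw [qAffPair_odd]
  ext1 <;> simp [h1]

theorem qAffPair_even_testFunction_theta (j k : ℕ) (h : k < j) (F : SF × SF) :
    qAffPair (2 * j) F ⟨0, 0, 0, coordX ^ k⟩ =
      (if j = k + 1 then -(k.factorial : ℂ) else 0) • F.2 := by
  have h1 := derivSmooth_pow_coordX_pow_of_lt h
  rw [qAffPair_even]
  split_ifs with e
  · subst e
    apply sf_ext <;> intro x <;> simp [h1, derivSmooth_pow_coordX_pow_self] <;> ring
  · have h3 := derivSmooth_pow_coordX_pow_of_lt (show k < j - 1 by omega)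
    ext1 <;> simp [h1, h3]

theorem qAffPair_odd_testFunction_theta (j k : ℕ) (h : k < j) (F : SF × SF) :
    qAffPair (2 * j + 1) F ⟨0, 0, 0, coordX ^ k⟩ = 0 := by
  have h1 := derivSmooth_pow_coordX_pow_of_lt h
  rw [qAffPair_odd]
  ext1 <;> simp [h1]

theorem qAffPair_testFunction_theta1 {k j : ℕ} (h : k ≤ j) (F : SF × SF) :
    qAffPair (2 * j + 1) F ⟨0, coordX ^ k, 0, 0⟩ =
      (if j = k then (k.factorial : ℂ) else 0) • F.1 := by
  rw [qAffPair_odd]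
  split_ifs with e
  · subst e
    ext1 <;> simp [derivSmooth_pow_coordX_pow_self]
  · ext1 <;> simp [derivSmooth_pow_coordX_pow_of_lt (show k < j by omega)]

theorem qAffPair_testFunction_theta2 {k j : ℕ} (h : k ≤ j) (F : SF × SF) :
    qAffPair (2 * j + 1) F ⟨0, 0, coordX ^ k, 0⟩ =
      (if j = k then (k.factorial : ℂ) else 0) • F.2 := by
  rw [qAffPair_odd]
  split_ifs with e
  · subst e
    ext1 <;> simp [derivSmooth_pow_coordX_pow_self]
  · ext1 <;> simp [derivSmooth_pow_coordX_pow_of_lt (show k < j by omega)]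

theorem qAffPair_even_testFunction_odd {k j : ℕ} (h : k < j) (F : SF × SF) :
    qAffPair (2 * j) F ⟨0, coordX ^ k, 0, 0⟩ = 0 ∧
      qAffPair (2 * j) F ⟨0, 0, coordX ^ k, 0⟩ = 0 := by
  have h1 := derivSmooth_pow_coordX_pow_of_lt h
  have h2 := derivSmooth_pow_coordX_pow_succ (show k < j - 1 + 1 by omega)
  rw [qAffPair_even, qAffPair_even]
  constructor <;> ext1 <;> simp [h1, h2]

/-- There is a test function detecting the first component of the symbol of degree `n / 2` of an
operator without components of lower degree. -/
theorem exists_testFunction_fst (n : ℕ) : ∃ (g : SF) (c : ℂ), c ≠ 0 ∧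
    ∀ m F, n ≤ m → qAffPair m F g = (if m = n then c else 0) • F.1 := by
  obtain ⟨k, rfl | rfl⟩ := n.even_or_odd'
  · refine ⟨⟨coordX ^ k, 0, 0, 0⟩, _, Nat.cast_ne_zero.2 k.factorial_ne_zero, fun m F hm => ?_⟩
    obtain ⟨j, rfl | rfl⟩ := m.even_or_odd'
    · rw [qAffPair_even_testFunction (by omega)]
      simp
    · rw [qAffPair_odd_testFunction (by omega), if_neg (by omega), zero_smul]
  · refine ⟨⟨0, coordX ^ k, 0, 0⟩, _, Nat.cast_ne_zero.2 k.factorial_ne_zero, fun m F hm => ?_⟩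
    obtain ⟨j, rfl | rfl⟩ := m.even_or_odd'
    · rw [(qAffPair_even_testFunction_odd (by omega) F).1, if_neg (by omega), zero_smul]
    · rw [qAffPair_testFunction_theta1 (by omega)]
      simp

theorem exists_testFunction_snd {n : ℕ} (hn : n ≠ 0) : ∃ (g : SF) (c : ℂ), c ≠ 0 ∧
    ∀ m F, n ≤ m → qAffPair m F g = (if m = n then c else 0) • F.2 := by
  obtain ⟨k, rfl | rfl⟩ := n.even_or_odd'
  · obtain ⟨k, rfl⟩ := Nat.exists_eq_succ_of_ne_zero (by omega : k ≠ 0)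
    -- The sign comes from `D̄₁D̄₂ (θ₁θ₂ xᵏ) = -xᵏ`.
    refine ⟨⟨0, 0, 0, coordX ^ k⟩, -(k.factorial : ℂ),
      neg_ne_zero.2 (Nat.cast_ne_zero.2 k.factorial_ne_zero), fun m F hm => ?_⟩
    obtain ⟨j, rfl | rfl⟩ := m.even_or_odd'
    · rw [qAffPair_even_testFunction_theta j k (by omega)]
      simp
    · rw [qAffPair_odd_testFunction_theta j k (by omega), if_neg (by omega), zero_smul]
  · refine ⟨⟨0, 0, coordX ^ k, 0⟩, _, Nat.cast_ne_zero.2 k.factorial_ne_zero, fun m F hm => ?_⟩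
    obtain ⟨j, rfl | rfl⟩ := m.even_or_odd'
    · rw [(qAffPair_even_testFunction_odd (by omega) F).2, if_neg (by omega), zero_smul]
    · rw [qAffPair_testFunction_theta2 (by omega)]
      simp

/-- Induction from the lowest degree upwards: components of lower degree are already zero, and the
test function for degree `n` kills all higher ones. Degree `0` has no test function for the second
component, whence the hypothesis on `s 0`. -/
theorem eq_zero_of_sum_qAffPair_eq_zero {N : ℕ} {s : ℕ → SF × SF} (h0 : (s 0).2 = 0)
    (h : ∑ m ∈ Finset.range N, qAffPair m (s m) = 0) (n : ℕ) (hn : n < N) : s n = 0 := by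
  induction n using Nat.strong_induction_on with
  | _ n ih =>
    have key (g : SF) (c : ℂ) (p : SF × SF → SF)
        (hg : ∀ m F, n ≤ m → qAffPair m F g = (if m = n then c else 0) • p F) :
        c • p (s n) = 0 := by
      have h' := congrArg (fun T : Op => T g) h
      simp only [LinearMap.sum_apply, LinearMap.zero_apply] at h'
      rw [Finset.sum_eq_single n] at h'
      · rwa [hg n _ le_rfl, if_pos rfl] at h'
      · intro m hm hmn
        rcases lt_or_gt_of_ne hmn with hlt | hlt
        · rw [ih m hlt (hlt.trans hn), map_zero, LinearMap.zero_apply]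
        · rw [hg m _ hlt.le, if_neg hmn, zero_smul]
      · intro hm
        exact absurd (Finset.mem_range.2 hn) hm
    obtain ⟨g, c, hc, hg⟩ := exists_testFunction_fst n
    have h1 : (s n).1 = 0 := (smul_eq_zero_iff_right hc).1 (key g c Prod.fst hg)
    refine Prod.ext h1 ?_
    rcases eq_or_ne n 0 with rfl | hn0
    · exact h0
    · obtain ⟨g, c, hc, hg⟩ := exists_testFunction_snd hn0
      exact (smul_eq_zero_iff_right hc).1 (key g c Prod.snd hg)

/-! ### Filtration of differential operators by affine symbols -/

/-- The operators of order less than `N / 2` obtained by affine quantization. -/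
def affineOpLT (N : ℕ) : Submodule ℂ Op :=
  Submodule.span ℂ {T | ∃ m < N, ∃ F : SF × SF, (m = 0 → F.2 = 0) ∧ T = qAffPair m F}

theorem qAffPair_mem_affineOpLT {m N : ℕ} (h : m < N) {F : SF × SF} (hF : m = 0 → F.2 = 0) :
    qAffPair m F ∈ affineOpLT N :=
  Submodule.subset_span ⟨m, h, F, hF, rfl⟩

theorem affineOpLT_mono {M N : ℕ} (h : M ≤ N) : affineOpLT M ≤ affineOpLT N :=
  Submodule.span_mono fun _ ⟨m, hm, F, hF, hT⟩ => ⟨m, hm.trans_le h, F, hF, hT⟩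

theorem exists_eq_sum_of_mem_affineOpLT {N : ℕ} {T : Op} (hT : T ∈ affineOpLT N) :
    ∃ s : ℕ → SF × SF, (s 0).2 = 0 ∧ T = ∑ m ∈ Finset.range N, qAffPair m (s m) := by
  induction hT using Submodule.span_induction with
  | mem T hT =>
    obtain ⟨n, hn, F, hF, rfl⟩ := hT
    refine ⟨Function.update 0 n F, ?_, ?_⟩
    · rcases eq_or_ne n 0 with rfl | h
      · simpa using hF rfl
      · rw [Function.update_of_ne h.symm]; rfl
    · rw [Finset.sum_eq_single n]
      · simp
      · intro m _ hm
        rw [Function.update_of_ne hm, Pi.zero_apply, map_zero]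
      · intro h
        exact absurd (Finset.mem_range.2 hn) h
  | zero => exact ⟨0, rfl, by simp⟩
  | add T T' _ _ ih ih' =>
    obtain ⟨s, hs, rfl⟩ := ih
    obtain ⟨s', hs', rfl⟩ := ih'
    exact ⟨s + s', by simp [hs, hs'], by simp [Finset.sum_add_distrib]⟩
  | smul c T _ ih =>
    obtain ⟨s, hs, rfl⟩ := ih
    exact ⟨c • s, by simp [hs], by simp [Finset.smul_sum]⟩

theorem Dbar1_mul_Dbar1 : Dbar1 * Dbar1 = -dx := by
  apply LinearMap.ext
  intro g
  ext1 <;> simp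

theorem Dbar2_mul_Dbar2 : Dbar2 * Dbar2 = -dx := by
  apply LinearMap.ext
  intro g
  ext1 <;> simp

theorem commute_dx_Dbar1 : Commute dx Dbar1 := by
  apply LinearMap.ext
  intro g
  ext1 <;> simp

theorem pow_eq_of_mul_self_eq_neg_dx {D : Op} (h : D * D = -dx) (m : ℕ) :
    ∃ c : ℂ, D ^ m = c • (dx ^ (m / 2) * D ^ (m % 2)) := by
  obtain ⟨k, rfl | rfl⟩ := m.even_or_odd'
  · refine ⟨(-1) ^ k, ?_⟩
    rw [pow_mul, pow_two, h, neg_pow]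
    simp [Algebra.smul_def]
  · refine ⟨(-1) ^ k, ?_⟩
    rw [pow_succ, pow_mul, pow_two, h, neg_pow, show (2 * k + 1) / 2 = k by omega,
      show (2 * k + 1) % 2 = 1 by omega]
    simp [Algebra.smul_def, mul_assoc]

/-- Because `D̄ᵢ² = -∂ₓ` and `∂ₓ` commutes with `D̄₁`, the exponents of `D̄₁` and `D̄₂` can be
reduced modulo two without changing the order. The four parity cases are exactly the shapes produced
by `qAffPair`. -/
theorem diffOpLT_le_affineOpLT (N : ℕ) : diffOpLT N ≤ affineOpLT N := by
  refine Submodule.span_le.2 ?_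
  rintro _ ⟨a, l, m, n, h, rfl⟩
  obtain ⟨c, hc⟩ := pow_eq_of_mul_self_eq_neg_dx Dbar1_mul_Dbar1 m
  obtain ⟨d, hd⟩ := pow_eq_of_mul_self_eq_neg_dx Dbar2_mul_Dbar2 n
  have e : mulL a * dx ^ l * Dbar1 ^ m * Dbar2 ^ n =
      (c * d) • (mulL a * dx ^ (l + m / 2 + n / 2) * Dbar1 ^ (m % 2) * Dbar2 ^ (n % 2)) := by
    rw [hc, hd, pow_add, pow_add]
    simp only [mul_smul_comm, smul_mul_assoc, smul_smul, mul_assoc]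
    rw [mul_comm d c, ← mul_assoc (Dbar1 ^ (m % 2)), ← mul_assoc (dx ^ (n / 2)),
      ((commute_dx_Dbar1.pow_pow (n / 2) (m % 2)).eq)]
  rw [e]
  refine Submodule.smul_mem _ _ ?_
  set k := l + m / 2 + n / 2 with hk
  rcases Nat.mod_two_eq_zero_or_one m with hm | hm <;>
    rcases Nat.mod_two_eq_zero_or_one n with hn | hn <;> rw [hm, hn]
  · convert qAffPair_mem_affineOpLT (m := 2 * k) (N := N) (by omega) (F := (a, 0))
      (fun _ => rfl) using 1
    simp [qAffPair]
  · convert qAffPair_mem_affineOpLT (m := 2 * k + 1) (N := N) (by omega) (F := (0, a))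
      (by simp) using 1
    simp [qAffPair, show (2 * k + 1) / 2 = k by omega]
  · convert qAffPair_mem_affineOpLT (m := 2 * k + 1) (N := N) (by omega) (F := (a, 0))
      (by simp) using 1
    simp [qAffPair, show (2 * k + 1) / 2 = k by omega]
  -- `∂ₓᵏ D̄₁D̄₂` has order `k + 1`, in agreement with the exponent `n / 2 - 1` in `qAffPair`.
  · convert qAffPair_mem_affineOpLT (m := 2 * (k + 1)) (N := N) (by omega) (F := (0, a))
      (by simp) using 1
    simp [qAffPair]

/-! ### Compatibility of the action with the filtration and with principal symbols. -/

theorem lieSymbolPair_add_left (del : ℂ) (n : ℕ) (f g : SF) (F : SF × SF) :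
    lieSymbolPair del n (f + g) F = lieSymbolPair del n f F + lieSymbolPair del n g F := by
  unfold lieSymbolPair
  split_ifs <;> ext1 <;> apply sf_ext <;> intro x <;> simp [lieDensity_add_left] <;> ring

theorem lieSymbolPair_smul_left (del c : ℂ) (n : ℕ) (f : SF) (F : SF × SF) :
    lieSymbolPair del n (c • f) F = c • lieSymbolPair del n f F := by
  unfold lieSymbolPair
  split_ifs <;> ext1 <;> apply sf_ext <;> intro x <;> simp [lieDensity_smul_left] <;> ring

theorem lieOp_qAffPair_sub_mem (lam mu : ℂ) {f : SF} (hf : f ∈ spo) (n : ℕ) (F : SF × SF)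
    (hF : n = 0 → F.2 = 0) :
    lieOp lam mu f (qAffPair n F) - qAffPair n (lieSymbolPair (mu - lam) n f F) ∈
      affineOpLT n := by
  induction hf using Submodule.span_induction with
  | mem f hf =>
    obtain ⟨i, rfl⟩ := hf
    rw [lieOp_qAffPair lam mu i n F hF, add_assoc, add_sub_cancel_left]
    refine Submodule.add_mem _ ?_ ?_
    · rcases eq_or_ne n 0 with rfl | hn
      · rw [corrOne, corr_zero _ _ _ _ (hF rfl), map_zero]
        exact Submodule.zero_mem _
      · exact qAffPair_mem_affineOpLT (by omega) (corr_snd lam n _ _ F hF)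
    · rcases eq_or_ne n 0 with rfl | hn
      · rw [corrTwo_zero, map_zero]
        exact Submodule.zero_mem _
      · exact qAffPair_mem_affineOpLT (by omega) (corrTwo_snd lam n _ F)
  | zero =>
    have h := lieSymbolPair_smul_left (mu - lam) 0 n 0 F
    rw [zero_smul, zero_smul] at h
    rw [h, map_zero, ← lieOpBilin_apply, map_zero, LinearMap.zero_apply, sub_zero]
    exact Submodule.zero_mem _
  | add f g _ _ ihf ihg =>
    rw [lieSymbolPair_add_left, map_add, ← lieOpBilin_apply, map_add, LinearMap.add_apply,
      add_sub_add_comm]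
    exact Submodule.add_mem _ ihf ihg
  | smul c f _ ih =>
    rw [lieSymbolPair_smul_left, map_smul, ← lieOpBilin_apply, map_smul, LinearMap.smul_apply,
      ← smul_sub]
    exact Submodule.smul_mem _ _ ih

theorem lieOp_mem_affineOpLT (lam mu : ℂ) {f : SF} (hf : f ∈ spo) {N : ℕ} {T : Op}
    (hT : T ∈ affineOpLT N) : lieOp lam mu f T ∈ affineOpLT N := by
  induction hT using Submodule.span_induction with
  | mem T hT =>
    obtain ⟨n, hn, F, hF, rfl⟩ := hT
    rw [← sub_add_cancel (lieOp lam mu f (qAffPair n F))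
      (qAffPair n (lieSymbolPair (mu - lam) n f F))]
    exact Submodule.add_mem _ (affineOpLT_mono hn.le (lieOp_qAffPair_sub_mem lam mu hf n F hF))
      (qAffPair_mem_affineOpLT hn (lieSymbolPair_snd _ n f F hF))
  | zero =>
    rw [← lieOpBilin_apply, map_zero]
    exact Submodule.zero_mem _
  | add T T' _ _ ih ih' =>
    rw [lieOp_add]
    exact Submodule.add_mem _ ih ih'
  | smul c T _ ih =>
    rw [← lieOpBilin_apply, map_smul]
    exact Submodule.smul_mem _ _ ih

/-! ### Symbols as finite sequences of pairs -/

/-- The symbol with components `s m` for `m < N`. -/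
def symbolOfSeq (N : ℕ) (s : ℕ → SF × SF) (h : (s 0).2 = 0) : Symbols :=
  ∑ m ∈ Finset.range N,
    DirectSum.lof ℂ ℕ (fun i => symbolSpace i) m ⟨s m, fun hm => by rw [hm]; exact h⟩

theorem symbolOfSeq_apply (N : ℕ) (s : ℕ → SF × SF) (h : (s 0).2 = 0) (j : ℕ) :
    (symbolOfSeq N s h j : SF × SF) = if j < N then s j else 0 := by
  have e : symbolOfSeq N s h j = ∑ m ∈ Finset.range N,
      (DirectSum.lof ℂ ℕ (fun i => symbolSpace i) m ⟨s m, fun hm => by rw [hm]; exact h⟩ :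
        Symbols) j :=
    DFinsupp.finsetSum_apply _ _ _
  rw [e]
  split_ifs with hj
  · rw [Finset.sum_eq_single j]
    · rw [DirectSum.lof_apply]
    · intro m _ hm
      rw [DirectSum.lof_eq_of]
      exact DirectSum.of_eq_of_ne _ _ _ (Ne.symm hm)
    · intro h'
      exact absurd (Finset.mem_range.2 hj) h'
  · rw [Finset.sum_eq_zero]
    · rfl
    · intro m hm
      rw [DirectSum.lof_eq_of]
      exact DirectSum.of_eq_of_ne _ _ _ (by have := Finset.mem_range.1 hm; omega)

theorem qAff_symbolOfSeq (N : ℕ) (s : ℕ → SF × SF) (h : (s 0).2 = 0) :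
    qAff (symbolOfSeq N s h) = ∑ m ∈ Finset.range N, qAffPair m (s m) := by
  simp only [symbolOfSeq, map_sum, qAff, DirectSum.toModule_lof]
  rfl

theorem symbol_snd (T : Symbols) : (T 0 : SF × SF).2 = 0 := (T 0).2 rfl

theorem qAff_eq_sum {N : ℕ} {T : Symbols} (hT : ∀ m, N ≤ m → T m = 0) :
    qAff T = ∑ m ∈ Finset.range N, qAffPair m (T m) := by
  have e : T = symbolOfSeq N (fun m => T m) (symbol_snd T) := by
    refine DFinsupp.ext fun j => Subtype.ext ?_
    rw [symbolOfSeq_apply]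
    split_ifs with hj
    · rfl
    · rw [hT j (not_lt.1 hj)]; rfl
  conv_lhs => rw [e]
  rw [qAff_symbolOfSeq]

/-! ### The eigenvalue equation in components -/

theorem sum_range_eq_sum_range_succ {M : Type*} [AddCommMonoid M] {f : ℕ → M} {N : ℕ}
    (h0 : f 0 = 0) (hN : f N = 0) :
    ∑ m ∈ Finset.range N, f m = ∑ m ∈ Finset.range N, f (m + 1) := by
  have h := Finset.sum_range_succ f N
  rw [Finset.sum_range_succ', h0, hN, add_zero, add_zero] at h
  exact h.symm

theorem corr_apply_zero (lam : ℂ) (n : ℕ) (u v : Op) : corr lam n u v 0 = 0 := by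
  unfold corr
  split_ifs <;> ext1 <;> simp

theorem corrTwo_apply_zero (lam : ℂ) (n : ℕ) (u : Op) : corrTwo lam n u 0 = 0 := by
  unfold corrTwo
  split_ifs <;> ext1 <;> simp

/-- The lowering terms are regrouped by target degree, shifting the index once for `corr` and twice
for `corrTwo`. The boundary terms vanish at the bottom by `A_0 = 0` and `h0`, at the top by `hs`. -/
theorem casimir_sum_qAffPair (lam mu : ℂ) {N : ℕ} {s : ℕ → SF × SF} (h0 : (s 0).2 = 0)
    (hs : ∀ m, N ≤ m → s m = 0) :
    casimir lam mu (∑ m ∈ Finset.range N, qAffPair m (s m)) =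
      ∑ m ∈ Finset.range N, qAffPair m (alpha (mu - lam) m • s m +
        corr lam (m + 1) Dbar1 Dbar2 (s (m + 1)) + corrTwo lam (m + 2) dx (s (m + 2))) := by
  have hc (m : ℕ) : casimirLin lam mu (qAffPair m (s m)) =
      alpha (mu - lam) m • qAffPair m (s m) +
      qAffPair (m - 1) (corr lam m Dbar1 Dbar2 (s m)) +
      qAffPair (m - 2) (corrTwo lam m dx (s m)) := by
    rw [casimirLin_apply, casimir_qAffPair]
    rintro rfl
    exact h0
  rw [← casimirLin_apply, map_sum]
  simp only [hc, map_add, map_smul, Finset.sum_add_distrib]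
  congr 1
  · congr 1
    refine (sum_range_eq_sum_range_succ ?_ ?_).trans ?_
    · rw [corr_zero _ _ _ _ h0, map_zero]
    · rw [hs N le_rfl, corr_apply_zero, map_zero]
    · rfl
  · refine (sum_range_eq_sum_range_succ ?_ ?_).trans
      ((sum_range_eq_sum_range_succ ?_ ?_).trans ?_)
    · rw [corrTwo_zero, map_zero]
    · rw [hs N le_rfl, corrTwo_apply_zero, map_zero]
    · rw [corrTwo_one, map_zero]
    · rw [hs (N + 1) (by omega), corrTwo_apply_zero, map_zero]
    · rfl

/-- A sequence of symbols which is annihilated by the Casimir operator minus `α_n`. -/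
def IsEigenSeq (lam mu : ℂ) (n : ℕ) (s : ℕ → SF × SF) : Prop :=
  ∀ j ≤ n, (alpha (mu - lam) n - alpha (mu - lam) j) • s j =
    corr lam (j + 1) Dbar1 Dbar2 (s (j + 1)) + corrTwo lam (j + 2) dx (s (j + 2))

theorem casimir_sum_eq_iff (lam mu : ℂ) {n : ℕ} {s : ℕ → SF × SF} (h0 : (s 0).2 = 0)
    (hs : ∀ m, n < m → s m = 0) :
    casimir lam mu (∑ m ∈ Finset.range (n + 1), qAffPair m (s m)) =
        alpha (mu - lam) n • ∑ m ∈ Finset.range (n + 1), qAffPair m (s m) ↔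
      IsEigenSeq lam mu n s := by
  rw [casimir_sum_qAffPair lam mu h0 (fun m hm => hs m hm), Finset.smul_sum]
  constructor
  · intro h j hj
    rw [← sub_eq_zero, ← Finset.sum_sub_distrib] at h
    simp only [← map_smul, ← map_sub] at h
    have h' := eq_zero_of_sum_qAffPair_eq_zero (by
      simp [h0, corr_snd lam 1 Dbar1 Dbar2 (s 1) (by simp) rfl,
        corrTwo_snd lam 2 dx (s 2) rfl]) h j (Nat.lt_succ_of_le hj)
    rw [sub_eq_zero] at h'
    rw [sub_smul, ← h']
    abel
  · intro h
    refine Finset.sum_congr rfl fun j hj => ?_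
    rw [add_assoc, ← h j (Nat.lt_succ_iff.1 (Finset.mem_range.1 hj)), ← map_smul]
    congr 1
    module

theorem isEigenLift_iff (lam mu : ℂ) (n : ℕ) (S : symbolSpace n) (T : Symbols) :
    IsEigenLift lam mu n S T ↔ (∀ m, n < m → T m = 0) ∧ T n = S ∧
      IsEigenSeq lam mu n (fun m => T m) := by
  refine and_congr_right fun hT => and_congr_right fun _ => ?_
  rw [qAff_eq_sum (N := n + 1) hT]
  exact casimir_sum_eq_iff lam mu (symbol_snd T) (fun m hm => by rw [hT m hm]; rfl)

/-! ### Uniqueness of eigenvectors with given principal symbol. -/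

theorem alpha_sub_ne_zero {del : ℂ} (hdel : ¬ IsCritical del) {j n : ℕ} (h : j < n) :
    alpha del n - alpha del j ≠ 0 :=
  sub_ne_zero.2 fun e => hdel ⟨n, j, h, e⟩

theorem IsEigenSeq.eq {lam mu : ℂ} (hdel : ¬ IsCritical (mu - lam)) {n : ℕ}
    {s t : ℕ → SF × SF} (hs : IsEigenSeq lam mu n s) (ht : IsEigenSeq lam mu n t)
    (h : ∀ m, n ≤ m → s m = t m) (j : ℕ) : s j = t j := by
  -- `i` bounds the distance of `j` below `n`; thus the induction hypothesis covers `j + 1` and `j +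
  -- 2` together, as the two-step recursion requires.
  suffices H : ∀ i j, n ≤ j + i → s j = t j from H n j (by omega)
  intro i
  induction i with
  | zero => exact fun j hj => h j hj
  | succ i ih =>
    intro j hj
    rcases le_or_gt n j with hn | hn
    · exact h j hn
    · have hc := alpha_sub_ne_zero hdel hn
      refine smul_right_injective _ hc ?_
      change (_ - _) • s j = (_ - _) • t j
      rw [hs j hn.le, ht j hn.le, ih (j + 1) (by omega), ih (j + 2) (by omega)]

theorem IsEigenLift.unique {lam mu : ℂ} (hdel : ¬ IsCritical (mu - lam)) {n : ℕ}
    {S : symbolSpace n} {T U : Symbols} (hT : IsEigenLift lam mu n S T)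
    (hU : IsEigenLift lam mu n S U) : T = U := by
  rw [isEigenLift_iff] at hT hU
  refine DFinsupp.ext fun j => Subtype.ext (hT.2.2.eq hdel hU.2.2 (fun m hm => ?_) j)
  rcases hm.eq_or_lt with rfl | hm
  · simp only [hT.2.1, hU.2.1]
  · simp only [hT.1 m hm, hU.1 m hm]

/-- An eigenvector of the Casimir operator is determined by its principal symbol. -/
theorem eq_qAff_of_casimir_eq {lam mu : ℂ} (hdel : ¬ IsCritical (mu - lam)) {n : ℕ}
    {S : symbolSpace n} {T : Symbols} (hT : IsEigenLift lam mu n S T) {R : Op}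
    (hR : R - qAffPair n S ∈ affineOpLT n)
    (hc : casimir lam mu R = alpha (mu - lam) n • R) : R = qAff T := by
  obtain ⟨s, hs0, hs⟩ := exists_eq_sum_of_mem_affineOpLT hR
  have hu0 : (Function.update s n (S : SF × SF) 0).2 = 0 := by
    rcases eq_or_ne n 0 with rfl | hn
    · simpa using S.2 rfl
    · rwa [Function.update_of_ne hn.symm]
  have hRU : R = qAff (symbolOfSeq (n + 1) (Function.update s n S) hu0) := by
    rw [qAff_symbolOfSeq, Finset.sum_range_succ, Function.update_self, ← sub_eq_iff_eq_add, hs]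
    refine Finset.sum_congr rfl fun m hm => ?_
    rw [Function.update_of_ne (Finset.mem_range.1 hm).ne]
  rw [hRU] at hc ⊢
  refine congrArg qAff (IsEigenLift.unique hdel ⟨fun m hm => Subtype.ext ?_, Subtype.ext ?_, hc⟩ hT)
  · rw [symbolOfSeq_apply, if_neg (by omega)]; rfl
  · rw [symbolOfSeq_apply, if_pos (by omega), Function.update_self]

/-! ### The explicit eigenvector -/

/-- The component of index `l` of the lift of `F`. -/
def integerComponent (lam mu : ℂ) (K l : ℕ) (F : SF × SF) : SF × SF :=
  coeffC lam mu K l • ((dx ^ l) F.1, (dx ^ l) F.2) +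
    coeffD lam mu K l •
      ((dx ^ l) F.1 - (Dbar1 * Dbar2 * dx ^ (l - 1)) F.2,
        (Dbar1 * Dbar2 * dx ^ (l - 1)) F.1 + (dx ^ l) F.2)

/-- The component of index `p + 1 / 2` of the lift of `F`. -/
def halfComponent (lam mu : ℂ) (K p : ℕ) (F : SF × SF) : SF × SF :=
  -(coeffE lam mu K p •
    (coeffB lam (K - p) • ((Dbar1 * dx ^ p) (par F.1) + (Dbar2 * dx ^ p) (par F.2)),
      coeffA (K - p) • ((Dbar2 * dx ^ p) (par F.1) - (Dbar1 * dx ^ p) (par F.2))))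

/-- The components of the lift of a symbol `F` of degree `K + 1 / 2`. -/
def liftSeq (lam mu : ℂ) (K : ℕ) (F : SF × SF) (m : ℕ) : SF × SF :=
  if 2 * K + 1 < m then 0
  else if Even m then halfComponent lam mu K (K - m / 2) F
  else integerComponent lam mu K (K - m / 2) F

/-- Writing `K = M + l`, with `M` fixing the target degree, removes the natural subtraction `K - l`
from the recursion. -/
theorem liftSeq_odd (lam mu : ℂ) (M l : ℕ) (F : SF × SF) :
    liftSeq lam mu (M + l) F (2 * M + 1) = integerComponent lam mu (M + l) l F := by
  have h : M + l - (2 * M + 1) / 2 = l := by omega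
  rw [liftSeq, if_neg (by omega), if_neg (by simp), h]

theorem liftSeq_even (lam mu : ℂ) (M p : ℕ) (F : SF × SF) :
    liftSeq lam mu (M + p) F (2 * M) = halfComponent lam mu (M + p) p F := by
  have h : M + p - (2 * M) / 2 = p := by omega
  rw [liftSeq, if_neg (by omega), if_pos (by simp), h]

theorem coeffD_eq (lam mu : ℂ) (K l : ℕ) :
    coeffD lam mu K l = -(l : ℂ) * coeffE lam mu K l := by
  rw [coeffD, coeffE, mul_div_assoc]

theorem alpha_odd (del : ℂ) (k : ℕ) :
    alpha del (2 * k + 1) = (-(k + 1 / 2 : ℂ) + del) ^ 2 - 1 / 4 := by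
  rw [alpha, if_neg (by simp)]
  push_cast
  ring

theorem alpha_even (del : ℂ) (k : ℕ) : alpha del (2 * k) = (-(k : ℂ) + del) ^ 2 := by
  rw [alpha, if_pos (by simp)]
  push_cast
  ring

theorem coeffC_eq {lam mu : ℂ} (hdel : ¬ IsCritical (mu - lam)) (K l : ℕ) : coeffC lam mu K l =
    2 * (alpha (mu - lam) (2 * K + 1) - alpha (mu - lam) (2 * K)) * coeffE lam mu K l := by
  have h := alpha_sub_ne_zero hdel (show 2 * K < 2 * K + 1 by omega)
  rw [coeffC, coeffE, ← mul_div_assoc, mul_div_mul_left _ _ (mul_ne_zero two_ne_zero h)]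

theorem coeffE_succ {lam mu : ℂ} (hdel : ¬ IsCritical (mu - lam)) (M l : ℕ) :
    (alpha (mu - lam) (2 * (M + (l + 1)) + 1) - alpha (mu - lam) (2 * M + 1)) *
      coeffE lam mu (M + (l + 1)) (l + 1) =
    coeffA (M + 1) * coeffB lam (M + 1) * coeffE lam mu (M + (l + 1)) l := by
  have h := alpha_sub_ne_zero hdel (show 2 * M + 1 < 2 * (M + (l + 1)) + 1 by omega)
  rw [coeffE, coeffE, Finset.prod_range_succ, Finset.prod_Icc_succ_top (by omega),
    show M + (l + 1) - l = M + 1 by omega,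
    show 2 * (M + (l + 1)) + 1 - 2 * (l + 1) = 2 * M + 1 by omega, ← mul_assoc (2 * _),
    ← mul_div_assoc, ← mul_div_assoc, mul_comm (_ - _) (_ * (_ * _)),
    mul_div_mul_right _ _ h, mul_comm (∏ i ∈ _, _) (coeffA _ * _)]

theorem coeffC_succ {lam mu : ℂ} (hdel : ¬ IsCritical (mu - lam)) (M l : ℕ) :
    (alpha (mu - lam) (2 * (M + (l + 1)) + 1) - alpha (mu - lam) (2 * M + 1)) *
      coeffC lam mu (M + (l + 1)) (l + 1) =
    coeffA (M + 1) * coeffB lam (M + 1) * coeffC lam mu (M + (l + 1)) l := by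
  rw [coeffC_eq hdel, coeffC_eq hdel]
  linear_combination (2 * (alpha (mu - lam) (2 * (M + (l + 1)) + 1) -
    alpha (mu - lam) (2 * (M + (l + 1))))) * coeffE_succ hdel M l

theorem coeffD_succ {lam mu : ℂ} (hdel : ¬ IsCritical (mu - lam)) (M l : ℕ) :
    (alpha (mu - lam) (2 * (M + (l + 1)) + 1) - alpha (mu - lam) (2 * M + 1)) *
      coeffD lam mu (M + (l + 1)) (l + 1) =
    coeffA (M + 1) * coeffB lam (M + 1) *
      (coeffD lam mu (M + (l + 1)) l - coeffE lam mu (M + (l + 1)) l) := by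
  rw [coeffD_eq, coeffD_eq]
  push_cast
  linear_combination (-((l : ℂ) + 1)) * coeffE_succ hdel M l

/-- Substituting `C' = 2 (α_k - α_{k-1/2}) E'` and `D' = -p E'` leaves an identity between
eigenvalues. It holds because `α_{m+1/2} - α_m = m - δ` for natural `m`, so that passing from `m =
M` to `m = M + p` changes this difference by exactly `p`. -/
theorem coeffE_relation {lam mu : ℂ} (hdel : ¬ IsCritical (mu - lam)) (M p : ℕ) :
    (alpha (mu - lam) (2 * (M + p) + 1) - alpha (mu - lam) (2 * M)) * coeffE lam mu (M + p) p =
      coeffC lam mu (M + p) p / 2 + coeffD lam mu (M + p) p +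
      (alpha (mu - lam) (2 * (M + p) + 1) - alpha (mu - lam) (2 * M + 1)) *
        coeffE lam mu (M + p) p := by
  rw [coeffC_eq hdel, coeffD_eq, alpha_odd, alpha_odd, alpha_even, alpha_even]
  push_cast
  ring

/-- The `A` and `B` of `corr` meet the `B` and `A` of the half-integer component, so all entries
share the factor `AB`. With `D̄ᵢ² = -∂ₓ` and `D̄₁D̄₂ = -D̄₂D̄₁`, the two first-order matrices
multiply to the matrix that accompanies `D'`. -/
theorem corr_halfComponent (lam mu : ℂ) (M l : ℕ) (F : SF × SF) :
    corr lam (2 * (M + 1)) Dbar1 Dbar2 (halfComponent lam mu (M + (l + 1)) l F) =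
      -(coeffA (M + 1) * coeffB lam (M + 1) * coeffE lam mu (M + (l + 1)) l) •
        ((dx ^ (l + 1)) F.1 - (Dbar1 * Dbar2 * dx ^ l) F.2,
          (Dbar1 * Dbar2 * dx ^ l) F.1 + (dx ^ (l + 1)) F.2) := by
  have e : M + (l + 1) - l = M + 1 := by omega
  rw [corr, if_pos (by simp), halfComponent, e, show 2 * (M + 1) / 2 = M + 1 by omega]
  ext1 <;> apply sf_ext <;> intro x <;> simp <;> ring

theorem corrTwo_integerComponent (lam mu : ℂ) (M l : ℕ) (F : SF × SF) :
    corrTwo lam (2 * (M + 1) + 1) dx (integerComponent lam mu (M + (l + 1)) l F) =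
      (coeffA (M + 1) * coeffB lam (M + 1)) •
        (coeffC lam mu (M + (l + 1)) l • ((dx ^ (l + 1)) F.1, (dx ^ (l + 1)) F.2) +
        coeffD lam mu (M + (l + 1)) l •
          ((dx ^ (l + 1)) F.1 - (Dbar1 * Dbar2 * dx ^ l) F.2,
            (Dbar1 * Dbar2 * dx ^ l) F.1 + (dx ^ (l + 1)) F.2)) := by
  rw [corrTwo, if_neg (by simp), integerComponent, show (2 * (M + 1) + 1) / 2 = M + 1 by omega]
  -- At `l = 0` the truncated exponent `l - 1` breaks the degree count, but `D'_0 = 0` removes the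
  -- term.
  rcases l with _ | l
  · have h : coeffD lam mu (M + (0 + 1)) 0 = 0 := by simp [coeffD]
    rw [h]
    ext1 <;> ext1 <;> simp
  · ext1 <;> apply sf_ext <;> intro x <;> simp

/-- Composed with the half-step correction, the matrix accompanying `D'` gives twice what `∂ₓᵖ`
times the identity gives, because `D̄₂D̄₁D̄₂ = D̄₁∂ₓ`. Hence the combination `C' / 2 + D'`. -/
theorem corr_integerComponent (lam mu : ℂ) (M p : ℕ) (F : SF × SF) :
    corr lam (2 * M + 1) Dbar1 Dbar2 (integerComponent lam mu (M + p) p F) =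
      -(coeffC lam mu (M + p) p / 2 + coeffD lam mu (M + p) p) •
        (coeffB lam M • ((Dbar1 * dx ^ p) (par F.1) + (Dbar2 * dx ^ p) (par F.2)),
          coeffA M • ((Dbar2 * dx ^ p) (par F.1) - (Dbar1 * dx ^ p) (par F.2))) := by
  rw [corr, if_neg (by simp), integerComponent, show (2 * M + 1) / 2 = M by omega]
  rcases p with _ | p
  · have h : coeffD lam mu (M + 0) 0 = 0 := by simp [coeffD]
    rw [h]
    ext1 <;> apply sf_ext <;> intro x <;> simp <;> ring
  · ext1 <;> apply sf_ext <;> intro x <;> simp <;> ring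

theorem corrTwo_halfComponent (lam mu : ℂ) (M p : ℕ) (F : SF × SF) :
    corrTwo lam (2 * (M + 1)) dx (halfComponent lam mu (M + (p + 1)) p F) =
      -(coeffA (M + 1) * coeffB lam (M + 1) * coeffE lam mu (M + (p + 1)) p) •
        (coeffB lam M • ((Dbar1 * dx ^ (p + 1)) (par F.1) + (Dbar2 * dx ^ (p + 1)) (par F.2)),
          coeffA M • ((Dbar2 * dx ^ (p + 1)) (par F.1) - (Dbar1 * dx ^ (p + 1)) (par F.2))) := by
  have e : M + (p + 1) - p = M + 1 := by omega
  rw [corrTwo, if_pos (by simp), halfComponent, e, show 2 * (M + 1) / 2 = M + 1 by omega,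
    Nat.add_sub_cancel]
  ext1 <;> apply sf_ext <;> intro x <;> simp <;> ring

theorem isEigenSeq_liftSeq {lam mu : ℂ} (hdel : ¬ IsCritical (mu - lam)) (K : ℕ) (F : SF × SF) :
    IsEigenSeq lam mu (2 * K + 1) (liftSeq lam mu K F) := by
  intro j hj
  have hz {m : ℕ} (h : 2 * K + 1 < m) : liftSeq lam mu K F m = 0 := if_pos h
  obtain ⟨M, rfl | rfl⟩ := j.even_or_odd'
  · obtain ⟨p, rfl⟩ := Nat.exists_eq_add_of_le (show M ≤ K by omega)
    rw [liftSeq_even, liftSeq_odd, corr_integerComponent]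
    have hE := coeffE_relation hdel M p
    rcases p with _ | p
    · rw [hz (by omega), corrTwo_apply_zero, halfComponent, show M + 0 - 0 = M by omega]
      rw [add_zero] at hE ⊢
      -- For `p = 0` the degree `2 * M + 1` is the top one, so the last term of the coefficient
      -- relation vanishes, just as the missing `corrTwo` contribution does.
      rw [add_zero, smul_neg, smul_smul, neg_smul, hE, sub_self, zero_mul, add_zero]
    · have e : 2 * M + 2 = 2 * (M + 1) := by ring
      have e' : M + (p + 1) = M + 1 + p := by ring
      have h2 : liftSeq lam mu (M + (p + 1)) F (2 * (M + 1)) =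
          halfComponent lam mu (M + (p + 1)) p F := by
        rw [e', liftSeq_even]
      rw [e, h2, corrTwo_halfComponent, halfComponent, show M + (p + 1) - (p + 1) = M by omega,
        smul_neg, smul_smul, ← neg_smul, ← add_smul]
      congr 1
      -- The last term of the coefficient relation becomes `A B E'_p`, the coefficient of the
      -- contribution from two half-steps above.
      linear_combination -hE - coeffE_succ hdel M p
  · obtain ⟨l, rfl⟩ := Nat.exists_eq_add_of_le (show M ≤ K by omega)
    rw [liftSeq_odd]
    rcases l with _ | l
    · rw [hz (by omega), hz (by omega), corr_apply_zero, corrTwo_apply_zero, add_zero, sub_self,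
        zero_smul, add_zero]
    · have e : 2 * M + 1 + 1 = 2 * (M + 1) := by ring
      have e2 : 2 * M + 1 + 2 = 2 * (M + 1) + 1 := by ring
      have e' : M + (l + 1) = M + 1 + l := by ring
      have h1 : liftSeq lam mu (M + (l + 1)) F (2 * (M + 1)) =
          halfComponent lam mu (M + (l + 1)) l F := by
        rw [e', liftSeq_even]
      have h2 : liftSeq lam mu (M + (l + 1)) F (2 * (M + 1) + 1) =
          integerComponent lam mu (M + (l + 1)) l F := by
        rw [e', liftSeq_odd]
      rw [e, e2, h1, h2, corr_halfComponent, corrTwo_integerComponent, integerComponent,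
        Nat.add_sub_cancel, smul_add, smul_smul, smul_smul, coeffC_succ hdel, coeffD_succ hdel]
      module

/-! ### The lift as an element of the symbol space, and equivariant quantizations. -/

theorem coeffE_zero (lam mu : ℂ) (K : ℕ) : coeffE lam mu K 0 =
    1 / (2 * (alpha (mu - lam) (2 * K + 1) - alpha (mu - lam) (2 * K))) := by
  simp [coeffE]

/-- In degree `0` the factor `A_{k-l}` is `A_0 = 0`, so the explicit formula does define a symbol
there. -/
theorem liftSeq_zero_snd (lam mu : ℂ) (K : ℕ) (F : SF × SF) : (liftSeq lam mu K F 0).2 = 0 := by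
  simp [liftSeq, halfComponent, coeffA]

/-- The lift of a symbol of degree `K + 1 / 2` to an eigenvector of the Casimir operator. -/
def casimirLift (lam mu : ℂ) (K : ℕ) (S : symbolSpace (2 * K + 1)) : Symbols :=
  symbolOfSeq (2 * K + 2) (liftSeq lam mu K S) (liftSeq_zero_snd lam mu K S)

theorem casimirLift_apply (lam mu : ℂ) (K : ℕ) (S : symbolSpace (2 * K + 1)) (j : ℕ) :
    (casimirLift lam mu K S j : SF × SF) = liftSeq lam mu K S j := by
  rw [casimirLift, symbolOfSeq_apply]
  split_ifs with h
  · rfl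
  · rw [liftSeq, if_pos (by omega)]

theorem isEigenLift_casimirLift {lam mu : ℂ} (hdel : ¬ IsCritical (mu - lam)) (K : ℕ)
    (S : symbolSpace (2 * K + 1)) :
    IsEigenLift lam mu (2 * K + 1) S (casimirLift lam mu K S) := by
  rw [isEigenLift_iff]
  refine ⟨fun m hm => Subtype.ext ?_, Subtype.ext ?_, ?_⟩
  · rw [casimirLift_apply, liftSeq, if_pos hm]; rfl
  · rw [casimirLift_apply]
    have h := liftSeq_odd lam mu K 0 S
    rw [add_zero] at h
    rw [h, integerComponent]
    ext1 <;> ext1 <;> simp [coeffC, coeffD]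
  · simp only [casimirLift_apply]
    exact isEigenSeq_liftSeq hdel K S

/-- An intertwiner carries the Casimir operator of symbols to that of operators, and the former is
the scalar `α_n` on symbols of degree `n / 2`. -/
theorem casimir_quantization {lam mu : ℂ} {Q : Symbols ≃ₗ[ℂ] diffOp}
    (hQ : IsEquivariantQuantization lam mu Q) (n : ℕ) (S : symbolSpace n) :
    casimir lam mu (Q (DirectSum.lof ℂ ℕ (fun i => symbolSpace i) n S)) =
      alpha (mu - lam) n •
        (Q (DirectSum.lof ℂ ℕ (fun i => symbolSpace i) n S) : Op) := by
  let P : symbolSpace n →ₗ[ℂ] Op := diffOp.subtype ∘ₗ Q.toLinearMap ∘ₗ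
    DirectSum.lof ℂ ℕ (fun i => symbolSpace i) n
  have h (i : Fin 8) (S : symbolSpace n) : lieOp lam mu (spoBasis i) (P S) =
      P (lieSymbol (mu - lam) n (spoBasis i) S) :=
    hQ.2 (spoBasis i) (Submodule.subset_span (Set.mem_range_self i)) n S
  change casimir lam mu (P S) = alpha (mu - lam) n • P S
  rw [casimir_eq]
  simp only [h, ← map_smul, ← map_sub, ← map_add]
  exact congrArg P (Subtype.ext (casimir_symbol (mu - lam) n S))

end SuperCircle

end

/-- Here `k = K + 1/2`, symbols of degree `j` are indexed by `2 j`, and `k - l` with `l = p + 1/2`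
is the natural number `K - p`. The operator `∂ₓ^(l-1)` occurs for `l = 0` only with the coefficient
`D'_0 = 0`. -/
theorem proposition5p2 (lam mu : ℂ) (hdel : ¬ SuperCircle.IsCritical (mu - lam)) (K : ℕ) :
    SuperCircle.coeffE lam mu K 0 =
      1 / (2 * (SuperCircle.alpha (mu - lam) (2 * K + 1) - SuperCircle.alpha (mu - lam) (2 * K))) ∧
    ∀ S : SuperCircle.symbolSpace (2 * K + 1),
      ∃ Shat : SuperCircle.Symbols,
        -- `Shat` is the unique eigenvector with leading term `S`
        SuperCircle.IsEigenLift lam mu (2 * K + 1) S Shat ∧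
        (∀ T : SuperCircle.Symbols, SuperCircle.IsEigenLift lam mu (2 * K + 1) S T → T = Shat) ∧
        -- it is the value at `S` of every equivariant quantization
        (∀ Q : SuperCircle.Symbols ≃ₗ[ℂ] SuperCircle.diffOp,
          SuperCircle.IsEquivariantQuantization lam mu Q →
            (Q (DirectSum.lof ℂ ℕ (fun i => SuperCircle.symbolSpace i) (2 * K + 1) S) :
              SuperCircle.Op) = SuperCircle.qAff Shat) ∧
        -- and it depends equivariantly on `S`
        (∀ f ∈ SuperCircle.spo, ∀ T : SuperCircle.Symbols,
          SuperCircle.IsEigenLift lam mu (2 * K + 1)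
            (SuperCircle.lieSymbol (mu - lam) (2 * K + 1) f S) T →
          SuperCircle.lieOp lam mu f (SuperCircle.qAff Shat) = SuperCircle.qAff T) ∧
        -- the components of natural index `l`
        (∀ l : ℕ, l ≤ K →
          (Shat (2 * K + 1 - 2 * l) : SuperCircle.SF × SuperCircle.SF) =
            SuperCircle.coeffC lam mu K l •
              ((SuperCircle.dx ^ l) S.1.1, (SuperCircle.dx ^ l) S.1.2) +
            SuperCircle.coeffD lam mu K l •
              ((SuperCircle.dx ^ l) S.1.1 -
                  (SuperCircle.Dbar1 * SuperCircle.Dbar2 * SuperCircle.dx ^ (l - 1)) S.1.2,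
                (SuperCircle.Dbar1 * SuperCircle.Dbar2 * SuperCircle.dx ^ (l - 1)) S.1.1 +
                  (SuperCircle.dx ^ l) S.1.2)) ∧
        -- the components of half-natural index `l = p + 1/2`
        (∀ p : ℕ, p ≤ K →
          (Shat (2 * (K - p)) : SuperCircle.SF × SuperCircle.SF) =
            -(SuperCircle.coeffE lam mu K p •
              (SuperCircle.coeffB lam (K - p) •
                  ((SuperCircle.Dbar1 * SuperCircle.dx ^ p) (SuperCircle.par S.1.1) +
                    (SuperCircle.Dbar2 * SuperCircle.dx ^ p) (SuperCircle.par S.1.2)),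
                SuperCircle.coeffA (K - p) •
                  ((SuperCircle.Dbar2 * SuperCircle.dx ^ p) (SuperCircle.par S.1.1) -
                    (SuperCircle.Dbar1 * SuperCircle.dx ^ p) (SuperCircle.par S.1.2))))) := by
  refine ⟨SuperCircle.coeffE_zero lam mu K, fun S => ⟨SuperCircle.casimirLift lam mu K S, ?_⟩⟩
  have hS := SuperCircle.isEigenLift_casimirLift hdel K S
  refine ⟨hS, fun T hT => hT.unique hdel hS, fun Q hQ => ?_, fun f hf T hT => ?_, fun l hl => ?_,
    fun p hp => ?_⟩
  · exact SuperCircle.eq_qAff_of_casimir_eq hdel hS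
      (SuperCircle.diffOpLT_le_affineOpLT _ (hQ.1 _ S)) (SuperCircle.casimir_quantization hQ _ S)
  -- The image of the lift under `X_f` has principal symbol `L_{X_f} S`, because the action
  -- preserves the filtration. It is an eigenvector for the same value by invariance of the Casimir
  -- operator.
  · refine SuperCircle.eq_qAff_of_casimir_eq hdel hT ?_ ?_
    · rw [SuperCircle.qAff_eq_sum (N := 2 * K + 1 + 1) hS.1, Finset.sum_range_succ, hS.2.1,
        SuperCircle.lieOp_add, add_sub_assoc]
      refine Submodule.add_mem _ (SuperCircle.lieOp_mem_affineOpLT lam mu hf ?_)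
        (SuperCircle.lieOp_qAffPair_sub_mem lam mu hf _ _ S.2)
      exact Submodule.sum_mem _ fun m hm =>
        SuperCircle.qAffPair_mem_affineOpLT (Finset.mem_range.1 hm)
          (SuperCircle.casimirLift lam mu K S m).2
    · rw [SuperCircle.casimir_lieOp lam mu hf, hS.2.2, ← SuperCircle.lieOpBilin_apply, map_smul,
        SuperCircle.lieOpBilin_apply]
  · obtain ⟨M, rfl⟩ := Nat.exists_eq_add_of_le' hl
    rw [SuperCircle.casimirLift_apply,
      show 2 * (M + l) + 1 - 2 * l = 2 * M + 1 by omega, SuperCircle.liftSeq_odd]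
    rfl
  · obtain ⟨M, rfl⟩ := Nat.exists_eq_add_of_le' hp
    rw [SuperCircle.casimirLift_apply, show 2 * (M + p - p) = 2 * M by omega,
      SuperCircle.liftSeq_even]
    rfl
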